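/- Let $N\ge 2$ and $p>1$. Let $V:\mathbb R^N\to\mathbb R$ be Lebesgue measurable with $\operatorname{ess\,inf}_{\mathbb R^N}V>0$. Let $$X=\Big\{u\in W^{1,p}(\mathbb R^N)\cap L^\infty(\mathbb R^N):\ \int_{\mathbb R^N}V|u|^p\,dx<\infty\Big\},\qquad \|u\|_X=\|u\|_V+|u|_\infty,$$ where $\|u\|_V=\big(\int_{\mathbb R^N}|\nabla u|^p\,dx+\int_{\mathbb R^N}V|u|^p\,dx\big)^{1/p}$, $\nabla u$ is the weak gradient and $|u|_\infty=\operatorname{ess\,sup}|u|$. Call $h:\mathbb R^N\times\mathbb R\to\mathbb R$ a $\mathcal C^k$-Carathéodory function if $h(\cdot,t)$ is measurable for all $t\in\mathbb R$ and $h(x,\cdot)$ is $\mathcal C^k$ for a.e. $x\in\mathbb R^N$. Assume that - $A:\mathbb R^N\times\mathbb R\to\mathbb R$ is a $\mathcal C^1$-Carathéodory function, with $A_t=\partial A/\partial t$, and for every $\rho>0$ the functions $\sup_{|t|\le\rho}|A(\cdot,t)|$ and $\sup_{|t|\le\rho}|A_t(\cdot,t)|$ belong to $L^\infty(\mathbb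 R^N)$; - $g:\mathbb R^N\times\mathbb R\to\mathbb R$ is a $\mathcal C^0$-Carathéodory function, and there are $a_1,a_2>0$ and $q\ge p$ such that $|g(x,t)|\le a_1|t|^{p-1}+a_2|t|^{q-1}$ for a.e. $x\in\mathbb R^N$ and all $t\in\mathbb R$. Put $G(x,t)=\int_0^t g(x,s)\,ds$ and, for $u,v\in X$, $$J(u)=\frac1p\int_{\mathbb R^N}A(x,u)|\nabla u|^p\,dx+\frac1p\int_{\mathbb R^N}V(x)|u|^p\,dx-\int_{\mathbb R^N}G(x,u)\,dx,$$ $$\langle dJ(u),v\rangle=\int_{\mathbb R^N}A(x,u)|\nabla u|^{p-2}\nabla u\cdot\nabla v\,dx+\frac1p\int_{\mathbb R^N}A_t(x,u)\,v\,|\nabla u|^p\,dx+\int_{\mathbb R^N}V(x)|u|^{p-2}uv\,dx-\int_{\mathbb R^N}g(x,u)v\,dx .$$ Then all these integrals converge absolutely and $dJ(u)$ is a continuous linear functional on $X$ for every $u\in X$. If $(u_n)_n\subset X$, $u\in X$ and $M>0$ are such that $u_n\to u$ a.e. in $\mathbb R^N$, $\|u_n-u\|_V\to0$ and $|u_n|_\infty\le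 M$ for all $n$, then $$J(u_n)\to J(u)\qquad\text{and}\qquad \|dJ(u_n)-dJ(u)\|_{X'}\to0\qquad\text{as } n\to\infty .$$ Moreover $J$ is of class $\mathcal C^1$ on $X$, with Fréchet differential at $u$ equal to $dJ(u)$. -/

import Mathlib

open MeasureTheory Filter Set
open scoped Topology ENNReal ContDiff

namespace WeightedSobolev

/-- The Euclidean space `ℝ^N`. -/
abbrev E (N : ℕ) : Type := EuclideanSpace ℝ (Fin N)

/-- `V : ℝ^N → ℝ` is Lebesgue measurable and `ess inf V > 0`. -/
structure IsPotential {N : ℕ} (V : E N → ℝ) : Prop where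
  aemeasurable : AEMeasurable V volume
  essInf_pos : 0 < essInf V volume

/-- `h : ℝ^N × ℝ → ℝ` is a `C^k`-Carathéodory function. -/
structure IsCaratheodory {N : ℕ} (k : ℕ) (h : E N → ℝ → ℝ) : Prop where
  aemeasurable : ∀ t : ℝ, AEMeasurable (fun x => h x t) volume
  contDiff : ∀ᵐ x ∂(volume : Measure (E N)), ContDiff ℝ k (h x)

/-- For every `ρ > 0` the function `x ↦ sup_{|t| ≤ ρ} |h(x, t)|` is essentially bounded.
The supremum is taken in `[0, ∞]`. -/
def LocallyEssBounded {N : ℕ} (h : E N → ℝ → ℝ) : Prop :=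
  ∀ ρ : ℝ, 0 < ρ →
    essSup (fun x : E N => ⨆ t ∈ Icc (-ρ) ρ, ‖h x t‖ₑ) volume < (⊤ : ℝ≥0∞)

/-- The partial derivative `∂h/∂t (x, t)`. -/
noncomputable def partialT {N : ℕ} (h : E N → ℝ → ℝ) (x : E N) (t : ℝ) : ℝ :=
  deriv (h x) t

/-- `|g(x, t)| ≤ a₁ |t|^(p-1) + a₂ |t|^(q-1)` for a.e. `x` and all `t`,
for some `a₁, a₂ > 0` and some `q ≥ p`. -/
def HasGrowth {N : ℕ} (p : ℝ) (g : E N → ℝ → ℝ) : Prop :=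
  ∃ a₁ a₂ q : ℝ, 0 < a₁ ∧ 0 < a₂ ∧ p ≤ q ∧
    ∀ᵐ x ∂(volume : Measure (E N)), ∀ t : ℝ,
      |g x t| ≤ a₁ * |t| ^ (p - 1) + a₂ * |t| ^ (q - 1)

/-- `G` is a weak (distributional) gradient of `u` on `ℝ^N`. -/
structure IsWeakGradient {N : ℕ} (u : E N → ℝ) (G : E N → E N) : Prop where
  locallyIntegrable : LocallyIntegrable u volume
  locallyIntegrable_grad : LocallyIntegrable G volume
  integral_eq : ∀ φ : E N → ℝ, ContDiff ℝ ∞ φ → HasCompactSupport φ → ∀ i : Fin N,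
    ∫ x, u x * fderiv ℝ φ x (EuclideanSpace.single i 1) = - ∫ x, G x i * φ x

/-- `u ∈ W^{1,p}(ℝ^N)`. -/
def MemSobolev {N : ℕ} (p : ℝ) (u : E N → ℝ) : Prop :=
  MemLp u (ENNReal.ofReal p) volume ∧
    ∃ G : E N → E N, MemLp G (ENNReal.ofReal p) volume ∧ IsWeakGradient u G

/-- `u ∈ W_V^{1,p}(ℝ^N) ∩ L^∞(ℝ^N)`. -/
structure MemX {N : ℕ} (p : ℝ) (V : E N → ℝ) (u : E N → ℝ) : Prop where
  memSobolev : MemSobolev p u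
  integrable_weight : Integrable (fun x => V x * |u x| ^ p) volume
  memLp_top : MemLp u ∞ volume

/-! ### Auxiliary facts, used only to see that `X` is a normed space -/

section aux

variable {N : ℕ} {p : ℝ} {V : E N → ℝ}

lemma IsPotential.ae_pos (hV : IsPotential V) : ∀ᵐ x, 0 < V x := by
  have h := hV.essInf_pos
  rw [essInf, Filter.liminf_eq] at h
  have hne : {a : ℝ | ∀ᶠ x in ae (volume : Measure (E N)), a ≤ V x}.Nonempty := by
    by_contra hne
    rw [Set.not_nonempty_iff_eq_empty] at hne
    rw [hne, Real.sSup_empty] at h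
    exact lt_irrefl _ h
  obtain ⟨a, ha, ha0⟩ := exists_lt_of_lt_csSup hne h
  filter_upwards [ha] with x hx using ha0.trans_le hx

lemma locallyIntegrable_coord {F : E N → E N} (hF : LocallyIntegrable F volume) (i : Fin N) :
    LocallyIntegrable (fun x => F x i) volume := fun x => by
  obtain ⟨s, hs, hF⟩ := hF x
  exact ⟨s, hs, (EuclideanSpace.proj i : E N →L[ℝ] ℝ).integrable_comp hF⟩

lemma IsWeakGradient.ae_unique {u : E N → ℝ} {G H : E N → E N}
    (hG : IsWeakGradient u G) (hH : IsWeakGradient u H) : G =ᵐ[volume] H := by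
  have key : ∀ i : Fin N, ∀ᵐ x, G x i = H x i := by
    intro i
    refine ae_eq_of_integral_contDiff_smul_eq
      (locallyIntegrable_coord hG.locallyIntegrable_grad i)
      (locallyIntegrable_coord hH.locallyIntegrable_grad i) fun φ hφ hc => ?_
    have h1 := hG.integral_eq φ hφ hc i
    have h2 := hH.integral_eq φ hφ hc i
    simp only [smul_eq_mul, mul_comm (φ _)]
    linarith
  filter_upwards [ae_all_iff.2 key] with x hx
  ext i
  exact hx i

lemma IsWeakGradient.congr_left {u v : E N → ℝ} {G : E N → E N}
    (hG : IsWeakGradient u G) (h : u =ᵐ[volume] v) : IsWeakGradient v G where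
  locallyIntegrable := hG.locallyIntegrable.congr h
  locallyIntegrable_grad := hG.locallyIntegrable_grad
  integral_eq φ hφ hc i := by
    rw [← hG.integral_eq φ hφ hc i]
    refine integral_congr_ae ?_
    filter_upwards [h] with x hx
    rw [hx]

lemma integrable_mul_of_contDiff {f ψ : E N → ℝ} (hf : LocallyIntegrable f volume)
    (hψ : Continuous ψ) (hc : HasCompactSupport ψ) :
    Integrable (fun x => f x * ψ x) volume := by
  simpa [mul_comm] using hf.integrable_smul_left_of_hasCompactSupport hψ hc

lemma continuous_fderiv_apply {φ : E N → ℝ} (hφ : ContDiff ℝ ∞ φ) (v : E N) :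
    Continuous fun x => fderiv ℝ φ x v :=
  (hφ.continuous_fderiv (by simp)).clm_apply continuous_const

lemma IsWeakGradient.add {u v : E N → ℝ} {G H : E N → E N}
    (hG : IsWeakGradient u G) (hH : IsWeakGradient v H) : IsWeakGradient (u + v) (G + H) where
  locallyIntegrable := hG.locallyIntegrable.add hH.locallyIntegrable
  locallyIntegrable_grad := hG.locallyIntegrable_grad.add hH.locallyIntegrable_grad
  integral_eq φ hφ hc i := by
    have c1 := continuous_fderiv_apply hφ (EuclideanSpace.single i 1)
    have c2 : HasCompactSupport fun x => fderiv ℝ φ x (EuclideanSpace.single i 1) :=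
      hc.fderiv_apply ℝ _
    simp only [Pi.add_apply, PiLp.add_apply, add_mul]
    rw [integral_add (integrable_mul_of_contDiff hG.locallyIntegrable c1 c2)
        (integrable_mul_of_contDiff hH.locallyIntegrable c1 c2),
      integral_add
        (integrable_mul_of_contDiff (locallyIntegrable_coord hG.locallyIntegrable_grad i)
          hφ.continuous hc)
        (integrable_mul_of_contDiff (locallyIntegrable_coord hH.locallyIntegrable_grad i)
          hφ.continuous hc),
      hG.integral_eq φ hφ hc i, hH.integral_eq φ hφ hc i]
    ring

lemma IsWeakGradient.smul {u : E N → ℝ} {G : E N → E N} (c : ℝ)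
    (hG : IsWeakGradient u G) : IsWeakGradient (c • u) (c • G) where
  locallyIntegrable := hG.locallyIntegrable.smul c
  locallyIntegrable_grad := hG.locallyIntegrable_grad.smul c
  integral_eq φ hφ hc i := by
    simp only [Pi.smul_apply, PiLp.smul_apply, smul_eq_mul, mul_assoc]
    rw [integral_const_mul, integral_const_mul, hG.integral_eq φ hφ hc i, mul_neg]

/-- The weighted function `V^(1/p) u`. -/
noncomputable def weighted (p : ℝ) (V u : E N → ℝ) (x : E N) : ℝ := V x ^ (1 / p) * u x

lemma weighted_rpow (hp : 1 < p) (hV : IsPotential V) (u : E N → ℝ) :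
    (fun x => ‖weighted p V u x‖ ^ p) =ᵐ[volume] fun x => V x * |u x| ^ p := by
  filter_upwards [hV.ae_pos] with x hx
  rw [weighted, norm_mul, Real.norm_eq_abs, Real.norm_eq_abs,
    abs_of_nonneg (Real.rpow_nonneg hx.le _),
    Real.mul_rpow (Real.rpow_nonneg hx.le _) (abs_nonneg _), ← Real.rpow_mul hx.le,
    one_div, inv_mul_cancel₀ (by linarith), Real.rpow_one]

lemma memLp_weighted_iff (hp : 1 < p) (hV : IsPotential V) {u : E N → ℝ}
    (hu : AEStronglyMeasurable u volume) :
    MemLp (weighted p V u) (ENNReal.ofReal p) volume ↔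
      Integrable (fun x => V x * |u x| ^ p) volume := by
  have hm : AEStronglyMeasurable (weighted p V u) volume :=
    ((hV.aemeasurable.pow_const _).mul hu.aemeasurable).aestronglyMeasurable
  rw [← integrable_congr (weighted_rpow hp hV u),
    ← integrable_norm_rpow_iff hm (by simp; linarith) ENNReal.ofReal_ne_top,
    ENNReal.toReal_ofReal (by linarith)]

lemma MemX.congr {u v : E N → ℝ} (hu : MemX p V u) (h : u =ᵐ[volume] v) : MemX p V v where
  memSobolev := by
    obtain ⟨h1, G, h2, h3⟩ := hu.memSobolev
    exact ⟨h1.ae_eq h, G, h2, h3.congr_left h⟩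
  integrable_weight := by
    refine hu.integrable_weight.congr ?_
    filter_upwards [h] with x hx
    rw [hx]
  memLp_top := hu.memLp_top.ae_eq h

lemma MemX.add (hp : 1 < p) (hV : IsPotential V) {u v : E N → ℝ} (hu : MemX p V u)
    (hv : MemX p V v) : MemX p V (u + v) where
  memSobolev := by
    obtain ⟨h1, G, h2, h3⟩ := hu.memSobolev
    obtain ⟨k1, H, k2, k3⟩ := hv.memSobolev
    exact ⟨h1.add k1, G + H, h2.add k2, h3.add k3⟩
  integrable_weight := by
    have h1 := (memLp_weighted_iff hp hV hu.memLp_top.1).2 hu.integrable_weight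
    have h2 := (memLp_weighted_iff hp hV hv.memLp_top.1).2 hv.integrable_weight
    refine (memLp_weighted_iff hp hV (hu.memLp_top.1.add hv.memLp_top.1)).1 ?_
    convert h1.add h2 using 1
    ext x
    simp [weighted, mul_add]
  memLp_top := hu.memLp_top.add hv.memLp_top

lemma MemX.smul (hp : 1 < p) (hV : IsPotential V) {u : E N → ℝ} (c : ℝ) (hu : MemX p V u) :
    MemX p V (c • u) where
  memSobolev := by
    obtain ⟨h1, G, h2, h3⟩ := hu.memSobolev
    exact ⟨h1.const_smul c, c • G, h2.const_smul c, h3.smul c⟩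
  integrable_weight := by
    have h1 := (memLp_weighted_iff hp hV hu.memLp_top.1).2 hu.integrable_weight
    refine (memLp_weighted_iff hp hV (hu.memLp_top.1.const_smul c)).1 ?_
    convert h1.const_smul c using 1
    ext x
    simp [weighted]
    ring
  memLp_top := hu.memLp_top.const_smul c

lemma MemX.zero (hp : 1 < p) : MemX p V (0 : E N → ℝ) where
  memSobolev := ⟨MemLp.zero, 0, MemLp.zero,
    ⟨(integrable_zero _ _ _).locallyIntegrable, (integrable_zero _ _ _).locallyIntegrable,
      by simp⟩⟩
  integrable_weight := by
    simp [Real.zero_rpow (by linarith : p ≠ 0)]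
  memLp_top := MemLp.zero

end aux

/-! ### The space `X = W_V^{1,p}(ℝ^N) ∩ L^∞(ℝ^N)` -/

/-- The linear space `W_V^{1,p}(ℝ^N) ∩ L^∞(ℝ^N)` of classes of a.e. equal functions. -/
def submoduleX {N : ℕ} {p : ℝ} {V : E N → ℝ} (hp : 1 < p) (hV : IsPotential V) :
    Submodule ℝ (E N →ₘ[volume] ℝ) where
  carrier := {u | MemX p V u}
  add_mem' {u v} hu hv :=
    (MemX.add hp hV hu hv).congr (AEEqFun.coeFn_add u v).symm
  zero_mem' := (MemX.zero hp).congr AEEqFun.coeFn_zero.symm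
  smul_mem' c u hu := (MemX.smul hp hV c hu).congr (AEEqFun.coeFn_smul c u).symm

/-- The space `X = W_V^{1,p}(ℝ^N) ∩ L^∞(ℝ^N)`. -/
def X {N : ℕ} {p : ℝ} {V : E N → ℝ} (hp : 1 < p) (hV : IsPotential V) : Type :=
  submoduleX hp hV

namespace X

section

variable {N : ℕ} {p : ℝ} {V : E N → ℝ} {hp : 1 < p} {hV : IsPotential V}

noncomputable instance : AddCommGroup (X hp hV) := inferInstanceAs (AddCommGroup (submoduleX hp hV))

noncomputable instance : Module ℝ (X hp hV) := inferInstanceAs (Module ℝ (submoduleX hp hV))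

/-- An element of `X` as a function (a representative of its class). -/
noncomputable instance : CoeFun (X hp hV) fun _ => E N → ℝ := ⟨fun u => (u.1 : E N → ℝ)⟩

lemma memX (u : X hp hV) : MemX p V u := u.2

/-- (A representative of) the weak gradient `∇u ∈ L^p(ℝ^N; ℝ^N)` of `u ∈ X`. -/
noncomputable def grad (u : X hp hV) : E N → E N := u.memX.memSobolev.2.choose

lemma memLp_grad (u : X hp hV) : MemLp u.grad (ENNReal.ofReal p) volume :=
  u.memX.memSobolev.2.choose_spec.1

lemma isWeakGradient_grad (u : X hp hV) : IsWeakGradient u u.grad :=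
  u.memX.memSobolev.2.choose_spec.2

/-- `‖u‖_V = (∫ |∇u|^p + ∫ V |u|^p)^(1/p)`. -/
noncomputable def normV (u : X hp hV) : ℝ :=
  ((∫ x, ‖u.grad x‖ ^ p) + ∫ x, V x * |u x| ^ p) ^ (1 / p)

/-- `|u|_∞ = ess sup |u|`. -/
noncomputable def normInfty (u : X hp hV) : ℝ := (eLpNorm u ∞ volume).toReal

/-- `‖u‖_X = ‖u‖_V + |u|_∞`. -/
noncomputable instance : Norm (X hp hV) := ⟨fun u => u.normV + u.normInfty⟩

lemma norm_def (u : X hp hV) : ‖u‖ = u.normV + u.normInfty := rfl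

lemma coe_add (u v : X hp hV) : (u + v : X hp hV) =ᵐ[volume] fun x => u x + v x :=
  AEEqFun.coeFn_add u.1 v.1

lemma coe_smul (c : ℝ) (u : X hp hV) : (c • u : X hp hV) =ᵐ[volume] fun x => c * u x :=
  AEEqFun.coeFn_smul c u.1

lemma grad_add (u v : X hp hV) : (u + v).grad =ᵐ[volume] u.grad + v.grad :=
  (u + v).isWeakGradient_grad.ae_unique
    ((u.isWeakGradient_grad.add v.isWeakGradient_grad).congr_left (coe_add u v).symm)

lemma grad_smul (c : ℝ) (u : X hp hV) : (c • u).grad =ᵐ[volume] c • u.grad :=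
  (c • u).isWeakGradient_grad.ae_unique
    ((u.isWeakGradient_grad.smul c).congr_left (coe_smul c u).symm)

lemma memLp_weighted (u : X hp hV) : MemLp (weighted p V u) (ENNReal.ofReal p) volume :=
  (memLp_weighted_iff hp hV u.memX.memLp_top.1).2 u.memX.integrable_weight

lemma integral_rpow_eq {F : Type*} [NormedAddCommGroup F] {f : E N → F} (hp : 1 < p)
    (hf : MemLp f (ENNReal.ofReal p) volume) :
    ∫ x, ‖f x‖ ^ p = (eLpNorm f (ENNReal.ofReal p) volume).toReal ^ p := by
  rw [hf.eLpNorm_eq_integral_rpow_norm (by simp; linarith) ENNReal.ofReal_ne_top,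
    ENNReal.toReal_ofReal (by linarith : 0 ≤ p)]
  have h0 : 0 ≤ ∫ x, ‖f x‖ ^ p := integral_nonneg fun x => Real.rpow_nonneg (norm_nonneg _) _
  rw [ENNReal.toReal_ofReal (Real.rpow_nonneg h0 _), ← Real.rpow_mul h0,
    inv_mul_cancel₀ (by linarith), Real.rpow_one]

/-- `‖u‖_V` as an `ℓ^p` combination of two `L^p` norms. -/
lemma normV_eq (u : X hp hV) : u.normV =
    ((eLpNorm u.grad (ENNReal.ofReal p) volume).toReal ^ p
      + (eLpNorm (weighted p V u) (ENNReal.ofReal p) volume).toReal ^ p) ^ (1 / p) := by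
  rw [normV, integral_rpow_eq hp u.memLp_grad, ← integral_rpow_eq hp u.memLp_weighted,
    integral_congr_ae (weighted_rpow hp hV u)]

lemma normV_nonneg (u : X hp hV) : 0 ≤ u.normV := by
  rw [normV_eq]
  positivity

lemma normInfty_nonneg (u : X hp hV) : 0 ≤ u.normInfty := ENNReal.toReal_nonneg

lemma eLpNorm_add_toReal_le {F : Type*} [NormedAddCommGroup F] {q : ℝ≥0∞} {f g h : E N → F}
    (hq : 1 ≤ q) (hf : MemLp f q volume) (hg : MemLp g q volume) (hh : h =ᵐ[volume] f + g) :
    (eLpNorm h q volume).toReal ≤ (eLpNorm f q volume).toReal + (eLpNorm g q volume).toReal := by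
  rw [eLpNorm_congr_ae hh, ← ENNReal.toReal_add hf.2.ne hg.2.ne]
  exact ENNReal.toReal_mono (ENNReal.add_ne_top.2 ⟨hf.2.ne, hg.2.ne⟩)
    (eLpNorm_add_le hf.1 hg.1 hq)

lemma normV_add_le (u v : X hp hV) : (u + v).normV ≤ u.normV + v.normV := by
  have hq : (1 : ℝ≥0∞) ≤ ENNReal.ofReal p := by simpa using hp.le
  have h1 := eLpNorm_add_toReal_le hq u.memLp_grad v.memLp_grad (grad_add u v)
  have hw : weighted p V (u + v : X hp hV) =ᵐ[volume] weighted p V u + weighted p V v := by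
    filter_upwards [coe_add u v] with x hx
    simp [weighted, hx, mul_add]
  have h2 := eLpNorm_add_toReal_le hq u.memLp_weighted v.memLp_weighted hw
  rw [normV_eq, normV_eq, normV_eq]
  have key := Real.Lp_add_le_of_nonneg (s := Finset.univ) (p := p)
    (f := ![(eLpNorm u.grad (ENNReal.ofReal p) volume).toReal,
      (eLpNorm (weighted p V u) (ENNReal.ofReal p) volume).toReal])
    (g := ![(eLpNorm v.grad (ENNReal.ofReal p) volume).toReal,
      (eLpNorm (weighted p V v) (ENNReal.ofReal p) volume).toReal]) hp.le
    (by intro i _; fin_cases i <;> simp) (by intro i _; fin_cases i <;> simp)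
  simp only [Fin.sum_univ_two, Matrix.cons_val_zero, Matrix.cons_val_one] at key
  refine le_trans ?_ key
  have hp0 : (0 : ℝ) ≤ p := by linarith
  gcongr

lemma normInfty_add_le (u v : X hp hV) : (u + v).normInfty ≤ u.normInfty + v.normInfty :=
  eLpNorm_add_toReal_le le_top u.memX.memLp_top v.memX.memLp_top (coe_add u v)

lemma normV_smul (c : ℝ) (u : X hp hV) : (c • u).normV = |c| * u.normV := by
  have hp0 : p ≠ 0 := by linarith
  have h1 : ∫ x, ‖(c • u).grad x‖ ^ p = |c| ^ p * ∫ x, ‖u.grad x‖ ^ p := by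
    rw [← integral_const_mul]
    refine integral_congr_ae ?_
    filter_upwards [grad_smul c u] with x hx
    rw [hx, Pi.smul_apply, norm_smul, Real.norm_eq_abs,
      Real.mul_rpow (abs_nonneg _) (norm_nonneg _)]
  have h2 : ∫ x, V x * |(c • u) x| ^ p = |c| ^ p * ∫ x, V x * |u x| ^ p := by
    rw [← integral_const_mul]
    refine integral_congr_ae ?_
    filter_upwards [coe_smul c u] with x hx
    rw [hx, abs_mul, Real.mul_rpow (abs_nonneg _) (abs_nonneg _)]
    ring
  have h3 : 0 ≤ (∫ x, ‖u.grad x‖ ^ p) + ∫ x, V x * |u x| ^ p := by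
    refine add_nonneg (integral_nonneg fun x => Real.rpow_nonneg (norm_nonneg _) _)
      (integral_nonneg_of_ae ?_)
    filter_upwards [hV.ae_pos] with x hx
    exact mul_nonneg hx.le (Real.rpow_nonneg (abs_nonneg _) _)
  rw [normV, h1, h2, ← mul_add, Real.mul_rpow (Real.rpow_nonneg (abs_nonneg _) _) h3,
    ← Real.rpow_mul (abs_nonneg _), mul_one_div_cancel hp0, Real.rpow_one, normV]

lemma normInfty_smul (c : ℝ) (u : X hp hV) : (c • u).normInfty = |c| * u.normInfty := by
  have h : (c • u : X hp hV) =ᵐ[volume] c • (u : E N → ℝ) := coe_smul c u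
  rw [normInfty, eLpNorm_congr_ae h, eLpNorm_const_smul, ENNReal.toReal_mul, normInfty]
  simp

lemma eq_zero_of_normInfty (u : X hp hV) (h : u.normInfty = 0) : u = 0 := by
  have h0 : eLpNorm u ∞ volume = 0 :=
    ((ENNReal.toReal_eq_zero_iff _).1 h).resolve_right u.memX.memLp_top.2.ne
  have h1 := (eLpNorm_eq_zero_iff u.memX.memLp_top.1 ENNReal.top_ne_zero).1 h0
  exact Subtype.ext (AEEqFun.ext (h1.trans AEEqFun.coeFn_zero.symm))

lemma normedSpaceCore : NormedSpace.Core ℝ (X hp hV) where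
  norm_nonneg u := add_nonneg u.normV_nonneg u.normInfty_nonneg
  norm_smul c u := by
    rw [norm_def, norm_def, normV_smul, normInfty_smul, Real.norm_eq_abs, mul_add]
  norm_triangle u v := by
    rw [norm_def, norm_def, norm_def]
    linarith [normV_add_le u v, normInfty_add_le u v]
  norm_eq_zero_iff u := by
    constructor
    · intro h
      rw [norm_def] at h
      exact eq_zero_of_normInfty u (by linarith [u.normV_nonneg, u.normInfty_nonneg])
    · rintro rfl
      rw [norm_def, ← zero_smul ℝ (0 : X hp hV), normV_smul, normInfty_smul]
      simp

noncomputable instance : NormedAddCommGroup (X hp hV) :=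
  NormedAddCommGroup.ofCore normedSpaceCore

noncomputable instance : NormedSpace ℝ (X hp hV) :=
  NormedSpace.ofCore normedSpaceCore

end

end X

/-! ### The functional -/

section functional

variable {N : ℕ} {p : ℝ} {V : E N → ℝ} {hp : 1 < p} {hV : IsPotential V}

/-- `G(x, t) = ∫_0^t g(x, s) ds`. -/
noncomputable def primitive (g : E N → ℝ → ℝ) (x : E N) (t : ℝ) : ℝ := ∫ s in (0 : ℝ)..t, g x s

/-- `J(u) = (1/p) ∫ A(x,u) |∇u|^p + (1/p) ∫ V |u|^p - ∫ G(x,u)`. -/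
noncomputable def energy (A g : E N → ℝ → ℝ) (u : X hp hV) : ℝ :=
  1 / p * (∫ x, A x (u x) * ‖u.grad x‖ ^ p) + 1 / p * (∫ x, V x * |u x| ^ p)
    - ∫ x, primitive g x (u x)

/-- `⟨dJ(u), v⟩ = ∫ A(x,u) |∇u|^(p-2) ∇u·∇v + (1/p) ∫ A_t(x,u) v |∇u|^p
  + ∫ V |u|^(p-2) u v - ∫ g(x,u) v`. -/
noncomputable def diffEnergy (A g : E N → ℝ → ℝ) (u v : X hp hV) : ℝ :=
  (∫ x, A x (u x) * ‖u.grad x‖ ^ (p - 2) * inner ℝ (u.grad x) (v.grad x))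
    + 1 / p * (∫ x, partialT A x (u x) * v x * ‖u.grad x‖ ^ p)
    + (∫ x, V x * |u x| ^ (p - 2) * u x * v x)
    - ∫ x, g x (u x) * v x

/-- All the integrals in `energy A g u` and in `diffEnergy A g u v` converge absolutely. -/
structure IntegralsConverge (A g : E N → ℝ → ℝ) (u v : X hp hV) : Prop where
  energy_A : Integrable (fun x => A x (u x) * ‖u.grad x‖ ^ p) volume
  energy_V : Integrable (fun x => V x * |u x| ^ p) volume
  energy_G : Integrable (fun x => primitive g x (u x)) volume
  diff_A : Integrable
    (fun x => A x (u x) * ‖u.grad x‖ ^ (p - 2) * inner ℝ (u.grad x) (v.grad x)) volume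
  diff_At : Integrable (fun x => partialT A x (u x) * v x * ‖u.grad x‖ ^ p) volume
  diff_V : Integrable (fun x => V x * |u x| ^ (p - 2) * u x * v x) volume
  diff_g : Integrable (fun x => g x (u x) * v x) volume

end functional

end WeightedSobolev

/-! On functions bounded by a fixed `ρ` the nonlinearities have pure power growth: `A` and `A_t` are
bounded, `|g(x,t)| ≤ C|t|^(p-1)` and `|G(x,t)| ≤ C|t|^p`. Hence `dJ(u)` is integration of `∇v`, `v`,
`V^(1/p) v`, `v` against four densities, lying in `L^p'`, `L^1`, `L^p'`, `L^p'` with `p' = p/(p-1)`.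
Hölder's inequality bounds the dual norm by the sum of the norms of the densities
(`exists_abs_pair_le`). The `L^1` density, which comes from `A_t |∇u|^p`, is the one that needs `v`
in `L^∞`.

Each density, and each integrand of `J`, is at most `C‖f‖^s` for some `f` among `∇u`, `V^(1/p) u`,
`u`, all in `L^p`. If `f_n → f` in `L^p` and the superpositions converge a.e., then they converge in
`L^(p/s)` by dominated convergence with a moving dominant (`tendsto_eLpNorm_sub_of_norm_le_rpow`).
The a.e. convergence of the gradients holds only along subsequences, which suffices because the
limit is always the same (`Admissible.tendsto_energy_differential`).

For the `C^1` claim, convergence in `X` implies `‖·‖_V` convergence, a.e. convergence and a uniform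
bound, so `dJ` is continuous. Differentiation under the integral sign gives the directional
derivatives of `J`, and the mean value inequality turns them into a Fréchet derivative
(`Admissible.hasFDerivAt_energy`). -/

namespace WeightedSobolev

/-! ### Superposition operators, dominated convergence and Hölder pairings on a measure space. -/

section general

variable {α : Type*} [MeasurableSpace α] {μ : Measure α}
variable {F₁ F₂ : Type*} [NormedAddCommGroup F₁] [NormedAddCommGroup F₂]

/-- A function that is measurable in the first and a.e. continuous in the second variable
agrees, off a null set of the first variable, with a jointly measurable function that is
continuous in the second variable. -/
lemma exists_measurable_modification {h : α → ℝ → ℝ}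
    (hm : ∀ t, AEMeasurable (fun x => h x t) μ) (hc : ∀ᵐ x ∂μ, Continuous (h x)) :
    ∃ k : α → ℝ → ℝ, Measurable (Function.uncurry k) ∧ ∀ᵐ x ∂μ, k x = h x := by
  -- Rational `t` form a countable family, so one null set serves all of them; continuity then
  -- recovers the remaining `t` as limits along rationals.
  have hgood : ∀ᵐ x ∂μ, Continuous (h x) ∧ ∀ q : ℚ, h x q = (hm q).mk _ x :=
    hc.and (ae_all_iff.2 fun q => (hm q).ae_eq_mk)
  obtain ⟨S, hSsub, hSm, hS0⟩ := exists_measurable_superset_of_null (ae_iff.1 hgood)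
  have hS : ∀ x, x ∉ S → Continuous (h x) ∧ ∀ q : ℚ, h x q = (hm q).mk _ x := by
    intro x hx
    by_contra hcon
    exact hx (hSsub hcon)
  classical
  let k : α → ℝ → ℝ := fun x t => if x ∈ S then 0 else h x t
  have hk : ∀ x, Continuous (k x) := by
    intro x
    by_cases hx : x ∈ S
    · simp only [k, if_pos hx]
      exact continuous_const
    · simp only [k, if_neg hx]
      exact (hS x hx).1
  have hkq : ∀ q : ℚ, Measurable fun x => k x q := by
    intro q
    have : (fun x => k x q) = fun x => if x ∈ S then 0 else (hm q).mk _ x := by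
      ext x
      by_cases hx : x ∈ S
      · simp [k, hx]
      · simp only [k, if_neg hx, (hS x hx).2 q]
    rw [this]
    exact Measurable.ite hSm measurable_const (hm q).measurable_mk
  have hkt : ∀ t : ℝ, Measurable fun x => k x t := by
    intro t
    obtain ⟨q, -, -, hq⟩ := Real.exists_seq_rat_strictMono_tendsto t
    exact measurable_of_tendsto_metrizable (fun n => hkq (q n))
      (tendsto_pi_nhds.2 fun x => ((hk x).tendsto t).comp hq)
  refine ⟨k, ?_, ?_⟩
  · have := measurable_uncurry_of_continuous_of_measurable (u := fun t x => k x t)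
      (fun x => hk x) hkt
    exact this.comp measurable_swap
  · filter_upwards [measure_eq_zero_iff_ae_notMem.1 hS0] with x hx
    ext t
    simp only [k, if_neg hx]

/-- Superposition of a Carathéodory function with a measurable function is measurable. -/
lemma aemeasurable_superposition {h : α → ℝ → ℝ} (hm : ∀ t, AEMeasurable (fun x => h x t) μ)
    (hc : ∀ᵐ x ∂μ, Continuous (h x)) {u : α → ℝ} (hu : AEMeasurable u μ) :
    AEMeasurable (fun x => h x (u x)) μ := by
  obtain ⟨k, hk, hkh⟩ := exists_measurable_modification hm hc
  refine (hk.comp_aemeasurable (aemeasurable_id.prodMk hu)).congr ?_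
  filter_upwards [hkh] with x hx
  exact congrFun hx (u x)

/-- A dominated convergence theorem in which the dominating function is perturbed by
functions with vanishing integrals. -/
lemma tendsto_lintegral_zero_of_le_add {a c : ℕ → α → ℝ≥0∞} {b : α → ℝ≥0∞}
    (ha : ∀ n, AEMeasurable (a n) μ) (hb : AEMeasurable b μ) (hb_fin : ∫⁻ x, b x ∂μ ≠ ⊤)
    (hle : ∀ n, ∀ᵐ x ∂μ, a n x ≤ b x + c n x)
    (hc : Tendsto (fun n => ∫⁻ x, c n x ∂μ) atTop (𝓝 0))
    (h0 : ∀ᵐ x ∂μ, Tendsto (fun n => a n x) atTop (𝓝 0)) :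
    Tendsto (fun n => ∫⁻ x, a n x ∂μ) atTop (𝓝 0) := by
  -- Truncation at `b` makes the usual dominated convergence theorem apply, and what lies above `b`
  -- is at most `c n`.
  have h1 : Tendsto (fun n => ∫⁻ x, min (a n x) (b x) ∂μ) atTop (𝓝 0) := by
    have := tendsto_lintegral_of_dominated_convergence' (μ := μ)
      (F := fun n x => min (a n x) (b x)) (f := fun _ => 0) b
      (fun n => (ha n).min hb) (fun n => ae_of_all _ fun x => min_le_right _ _) hb_fin ?_
    · simpa using this
    · filter_upwards [h0] with x hx
      simpa using hx.min (tendsto_const_nhds (x := b x))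
  have h2 := h1.add hc
  rw [add_zero] at h2
  refine tendsto_of_tendsto_of_tendsto_of_le_of_le tendsto_const_nhds h2
    (fun n => zero_le) fun n => ?_
  rw [← lintegral_add_left' ((ha n).min hb)]
  refine lintegral_mono_ae ?_
  filter_upwards [hle n] with x hx
  rcases le_total (a n x) (b x) with h | h
  · simp only [min_eq_left h]
    exact le_self_add
  · simpa only [min_eq_right h] using hx

/-- The power `‖f‖^s` lies in `L^(p/s)`, and `p/s = r`. The pairs used are `s = p - 1`, `r =
p/(p-1)` and `s = p`, `r = 1`. -/
lemma memLp_of_norm_le_rpow {p r s C : ℝ} (hs : 0 < s) (hsr : s * r = p)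
    {f : α → F₁} {F : α → F₂} (hf : MemLp f (ENNReal.ofReal p) μ)
    (hF : AEStronglyMeasurable F μ) (hle : ∀ᵐ x ∂μ, ‖F x‖ ≤ C * ‖f x‖ ^ s) :
    MemLp F (ENNReal.ofReal r) μ := by
  have h := hf.norm_rpow_div (ENNReal.ofReal s)
  rw [ENNReal.toReal_ofReal hs.le, ← ENNReal.ofReal_div_of_pos hs, ← hsr,
    mul_div_cancel_left₀ _ hs.ne'] at h
  refine (h.const_mul C).mono hF ?_
  filter_upwards [hle] with x hx
  exact hx.trans (le_abs_self _)

/-- Each `Fn n` is controlled by its own `fn n`, so no fixed dominating function is at hand. But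
`‖Fn n - F‖^r` is at most `K‖f‖^p + K‖fn n - f‖^p`: a fixed integrable function plus terms whose
integrals vanish in the limit. -/
lemma tendsto_eLpNorm_sub_of_norm_le_rpow {p r s C : ℝ} (hr : 0 < r) (hs : 0 < s)
    (hsr : s * r = p) (hC : 0 ≤ C) {f : α → F₁} {fn : ℕ → α → F₁}
    (hf : MemLp f (ENNReal.ofReal p) μ)
    (hfn : Tendsto (fun n => eLpNorm (fun x => fn n x - f x) (ENNReal.ofReal p) μ) atTop (𝓝 0))
    {F : α → F₂} {Fn : ℕ → α → F₂}
    (hF : AEStronglyMeasurable F μ) (hFn : ∀ n, AEStronglyMeasurable (Fn n) μ)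
    (hle : ∀ᵐ x ∂μ, ‖F x‖ ≤ C * ‖f x‖ ^ s)
    (hlen : ∀ n, ∀ᵐ x ∂μ, ‖Fn n x‖ ≤ C * ‖fn n x‖ ^ s)
    (hlim : ∀ᵐ x ∂μ, Tendsto (fun n => Fn n x) atTop (𝓝 (F x))) :
    Tendsto (fun n => eLpNorm (fun x => Fn n x - F x) (ENNReal.ofReal r) μ) atTop (𝓝 0) := by
  have hp : 0 < p := hsr ▸ mul_pos hs hr
  have hp' : ENNReal.ofReal p ≠ 0 := by simpa using hp
  have hr' : ENNReal.ofReal r ≠ 0 := by simpa using hr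
  -- With `m = max ‖f‖ ‖fn n - f‖`, both `‖f‖` and `‖fn n‖` are at most `2m`, so `‖Fn n - F‖ ≤
  -- 2C(2m)^s`; its `r`-th power is `K m^p`, because `s r = p`.
  set K : ℝ := (2 * C) ^ r * 2 ^ p with hK
  have hK0 : 0 ≤ K := by positivity
  have hfin : ∫⁻ x, ‖f x‖ₑ ^ p ∂μ < ⊤ := by
    have := (eLpNorm_lt_top_iff_lintegral_rpow_enorm_lt_top hp' ENNReal.ofReal_ne_top).1 hf.2
    rwa [ENNReal.toReal_ofReal hp.le] at this
  have hfn' : Tendsto (fun n => ∫⁻ x, ‖fn n x - f x‖ₑ ^ p ∂μ) atTop (𝓝 0) := by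
    have h1 := (ENNReal.continuous_rpow_const (y := p)).tendsto 0 |>.comp hfn
    rw [ENNReal.zero_rpow_of_pos hp] at h1
    refine h1.congr fun n => ?_
    simp only [Function.comp]
    rw [eLpNorm_eq_lintegral_rpow_enorm_toReal hp' ENNReal.ofReal_ne_top,
      ENNReal.toReal_ofReal hp.le, ← ENNReal.rpow_mul, one_div, inv_mul_cancel₀ hp.ne',
      ENNReal.rpow_one]
  have key : Tendsto (fun n => ∫⁻ x, ‖Fn n x - F x‖ₑ ^ r ∂μ) atTop (𝓝 0) := by
    refine tendsto_lintegral_zero_of_le_add (b := fun x => ENNReal.ofReal K * ‖f x‖ₑ ^ p)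
      (c := fun n x => ENNReal.ofReal K * ‖fn n x - f x‖ₑ ^ p)
      (fun n => ((hFn n).sub hF).enorm.pow_const _) ((hf.1.enorm.pow_const _).const_mul _)
      ?_ ?_ ?_ ?_
    · rw [lintegral_const_mul' _ _ ENNReal.ofReal_ne_top]
      exact ENNReal.mul_ne_top ENNReal.ofReal_ne_top hfin.ne
    · intro n
      filter_upwards [hle, hlen n] with x h1 h2
      have hreal : ‖Fn n x - F x‖ ^ r ≤ K * ‖f x‖ ^ p + K * ‖fn n x - f x‖ ^ p := by
        set m := max ‖f x‖ ‖fn n x - f x‖ with hm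
        have hm0 : 0 ≤ m := le_max_of_le_left (norm_nonneg _)
        have h3 : ‖f x‖ ≤ 2 * m := by linarith [le_max_left ‖f x‖ ‖fn n x - f x‖]
        have h4 : ‖fn n x‖ ≤ 2 * m := by
          have h := norm_add_le (f x) (fn n x - f x)
          rw [add_sub_cancel] at h
          linarith [le_max_left ‖f x‖ ‖fn n x - f x‖, le_max_right ‖f x‖ ‖fn n x - f x‖]
        have h5 : ‖Fn n x - F x‖ ≤ 2 * C * (2 * m) ^ s := by
          have e1 : ‖f x‖ ^ s ≤ (2 * m) ^ s := Real.rpow_le_rpow (norm_nonneg _) h3 hs.le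
          have e2 : ‖fn n x‖ ^ s ≤ (2 * m) ^ s := Real.rpow_le_rpow (norm_nonneg _) h4 hs.le
          have e3 := mul_le_mul_of_nonneg_left e1 hC
          have e4 := mul_le_mul_of_nonneg_left e2 hC
          linarith [norm_sub_le (Fn n x) (F x)]
        have h6 : ‖Fn n x - F x‖ ^ r ≤ K * m ^ p := by
          refine (Real.rpow_le_rpow (norm_nonneg _) h5 hr.le).trans_eq ?_
          rw [Real.mul_rpow (by positivity) (by positivity), ← Real.rpow_mul (by positivity),
            hsr, Real.mul_rpow (by norm_num) hm0, hK]
          ring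
        refine h6.trans ?_
        rw [← mul_add]
        refine mul_le_mul_of_nonneg_left ?_ hK0
        rcases max_choice ‖f x‖ ‖fn n x - f x‖ with h | h <;> rw [hm, h]
        · linarith [Real.rpow_nonneg (norm_nonneg (fn n x - f x)) p]
        · linarith [Real.rpow_nonneg (norm_nonneg (f x)) p]
      simp only [← ofReal_norm]
      rw [ENNReal.ofReal_rpow_of_nonneg (norm_nonneg _) hr.le,
        ENNReal.ofReal_rpow_of_nonneg (norm_nonneg _) hp.le,
        ENNReal.ofReal_rpow_of_nonneg (norm_nonneg _) hp.le, ← ENNReal.ofReal_mul hK0,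
        ← ENNReal.ofReal_mul hK0, ← ENNReal.ofReal_add (by positivity) (by positivity)]
      exact ENNReal.ofReal_le_ofReal hreal
    · simp_rw [lintegral_const_mul' _ _ (ENNReal.ofReal_ne_top (r := K))]
      simpa using ENNReal.Tendsto.const_mul hfn' (Or.inr (ENNReal.ofReal_ne_top (r := K)))
    · filter_upwards [hlim] with x hx
      have h1 : Tendsto (fun n => ‖Fn n x - F x‖ₑ) atTop (𝓝 0) := by
        simpa using (hx.sub_const (F x)).enorm
      have h2 := (ENNReal.continuous_rpow_const (y := r)).tendsto 0 |>.comp h1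
      rwa [ENNReal.zero_rpow_of_pos hr] at h2
  have h1 := (ENNReal.continuous_rpow_const (y := 1 / r)).tendsto 0 |>.comp key
  rw [ENNReal.zero_rpow_of_pos (by positivity)] at h1
  refine h1.congr fun n => ?_
  rw [eLpNorm_eq_lintegral_rpow_enorm_toReal hr' ENNReal.ofReal_ne_top,
    ENNReal.toReal_ofReal hr.le]
  rfl

/-- Hölder's inequality for a pairing dominated by the product of the norms. -/
lemma integrable_pairing {q r : ℝ≥0∞} [ENNReal.HolderTriple q r 1] {b : F₁ → F₂ → ℝ}
    (hb : ∀ y z, ‖b y z‖ ≤ ‖y‖ * ‖z‖) {f : α → F₁} {g : α → F₂}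
    (hf : MemLp f q μ) (hg : MemLp g r μ)
    (hm : AEStronglyMeasurable (fun x => b (f x) (g x)) μ) :
    Integrable (fun x => b (f x) (g x)) μ ∧
      |∫ x, b (f x) (g x) ∂μ| ≤ (eLpNorm f q μ).toReal * (eLpNorm g r μ).toReal := by
  have h := eLpNorm_le_eLpNorm_mul_eLpNorm'_of_norm (p := q) (q := r) (r := 1) hf.1 hg.1 b 1
    (ae_of_all _ fun x => by simpa using hb (f x) (g x))
  rw [ENNReal.coe_one, one_mul] at h
  have hfin : eLpNorm f q μ * eLpNorm g r μ ≠ ⊤ := ENNReal.mul_ne_top hf.2.ne hg.2.ne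
  have hint : Integrable (fun x => b (f x) (g x)) μ :=
    memLp_one_iff_integrable.1 ⟨hm, h.trans_lt hfin.lt_top⟩
  refine ⟨hint, ?_⟩
  rw [← ENNReal.toReal_mul, ← Real.norm_eq_abs]
  refine (norm_integral_le_lintegral_norm _).trans ?_
  refine ENNReal.toReal_mono hfin (le_trans (le_of_eq ?_) h)
  rw [eLpNorm_one_eq_lintegral_enorm]
  simp only [ofReal_norm]

lemma tendsto_integral_of_tendsto_eLpNorm_one {F : α → ℝ} {Fn : ℕ → α → ℝ}
    (hF : Integrable F μ) (hFn : ∀ n, Integrable (Fn n) μ)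
    (h : Tendsto (fun n => eLpNorm (fun x => Fn n x - F x) (ENNReal.ofReal 1) μ) atTop (𝓝 0)) :
    Tendsto (fun n => ∫ x, Fn n x ∂μ) atTop (𝓝 (∫ x, F x ∂μ)) := by
  refine tendsto_integral_of_L1' F hF.1 (Eventually.of_forall hFn) ?_
  simpa using! h

end general

/-! ### The map `z ↦ ‖z‖^(p-2) z`. -/

section rpow

variable {F : Type*} [NormedAddCommGroup F] [InnerProductSpace ℝ F]

/-- At `z = 0` the value assigned to `0^(p-2)` is irrelevant, since it multiplies `0`; the right
side vanishes there because `p > 1`. Thus the range `1 < p < 2` needs no separate treatment. -/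
lemma norm_rpow_sub_two_smul {p : ℝ} (hp : 1 < p) (z : F) :
    ‖‖z‖ ^ (p - 2) • z‖ = ‖z‖ ^ (p - 1) := by
  rw [norm_smul, Real.norm_eq_abs, abs_of_nonneg (Real.rpow_nonneg (norm_nonneg _) _)]
  rcases (norm_nonneg z).eq_or_lt with h | h
  · rw [← h, mul_zero, Real.zero_rpow (by linarith)]
  · rw [← Real.rpow_add_one h.ne']
    ring_nf

/-- Only the origin is delicate for `p < 2`: there the norm of the map is `‖z‖^(p-1)`, which tends
to `0`. -/
lemma continuous_rpow_sub_two_smul {p : ℝ} (hp : 1 < p) :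
    Continuous fun z : F => ‖z‖ ^ (p - 2) • z := by
  rw [continuous_iff_continuousAt]
  intro z
  by_cases hz : z = 0
  · subst hz
    rw [ContinuousAt, smul_zero, tendsto_zero_iff_norm_tendsto_zero]
    simp_rw [norm_rpow_sub_two_smul hp]
    have : ContinuousAt (fun z : F => ‖z‖ ^ (p - 1)) 0 :=
      (continuous_norm.rpow_const fun _ => Or.inr (by linarith)).continuousAt
    simpa [ContinuousAt, Real.zero_rpow (by linarith : p - 1 ≠ 0)] using this
  · exact ((continuous_norm.continuousAt).rpow_const (Or.inl (norm_ne_zero_iff.2 hz))).smul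
      continuousAt_id

end rpow

/-! ### Bounds and measurability for `V`, `A`, `A_t`, `g` and `G`. -/

section nonlinearities

variable {N : ℕ} {p : ℝ}

/-- A real `essInf` is the `sSup` of the a.e. lower bounds, with default value `0` on the empty set;
positivity excludes that default and yields a positive lower bound. -/
lemma IsPotential.exists_ae_ge {V : E N → ℝ} (hV : IsPotential V) :
    ∃ a, 0 < a ∧ ∀ᵐ x, a ≤ V x := by
  have h := hV.essInf_pos
  rw [essInf, Filter.liminf_eq] at h
  have hne : {a : ℝ | ∀ᶠ x in ae (volume : Measure (E N)), a ≤ V x}.Nonempty := by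
    by_contra hne
    rw [Set.not_nonempty_iff_eq_empty] at hne
    rw [hne, Real.sSup_empty] at h
    exact lt_irrefl _ h
  obtain ⟨a, ha, ha0⟩ := exists_lt_of_lt_csSup hne h
  exact ⟨a, ha0, ha⟩

lemma IsCaratheodory.ae_continuous {k : ℕ} {h : E N → ℝ → ℝ} (hh : IsCaratheodory k h) :
    ∀ᵐ x ∂(volume : Measure (E N)), Continuous (h x) := by
  filter_upwards [hh.contDiff] with x hx using hx.continuous

lemma IsCaratheodory.ae_hasDerivAt {h : E N → ℝ → ℝ} (hh : IsCaratheodory 1 h) :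
    ∀ᵐ x ∂(volume : Measure (E N)), ∀ t, HasDerivAt (h x) (partialT h x t) t := by
  filter_upwards [hh.contDiff] with x hx t
  exact (hx.differentiable (by simp) t).hasDerivAt

/-- Measurability passes to the limit of the difference quotients with steps `1/(n+1)`. -/
lemma IsCaratheodory.partialT {h : E N → ℝ → ℝ} (hh : IsCaratheodory 1 h) :
    IsCaratheodory 0 (partialT h) where
  aemeasurable t := by
    have hlim : Tendsto (fun n : ℕ => ((n : ℝ) + 1)⁻¹) atTop (𝓝[≠] 0) := by
      refine tendsto_nhdsWithin_iff.2 ⟨?_, Eventually.of_forall fun n => ?_⟩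
      · simpa using tendsto_one_div_add_atTop_nhds_zero_nat (𝕜 := ℝ)
      · exact inv_ne_zero (by positivity)
    refine aemeasurable_of_tendsto_metrizable_ae atTop
      (f := fun (n : ℕ) x => (((n : ℝ) + 1)⁻¹)⁻¹ • (h x (t + ((n : ℝ) + 1)⁻¹) - h x t))
      (fun n => ((hh.aemeasurable (t + ((n : ℝ) + 1)⁻¹)).sub (hh.aemeasurable t)).const_smul
        (((n : ℝ) + 1)⁻¹)⁻¹) ?_
    filter_upwards [hh.ae_hasDerivAt] with x hx
    exact (hasDerivAt_iff_tendsto_slope_zero.1 (hx t)).comp hlim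
  contDiff := by
    filter_upwards [hh.contDiff] with x hx
    exact contDiff_zero.2 (hx.continuous_deriv (by simp))

/-- Since the supremum over `t` stands inside the essential supremum, a single null set works for
all `t` at once, as is needed to insert `t = u x`. -/
lemma LocallyEssBounded.exists_bound {h : E N → ℝ → ℝ} (hh : LocallyEssBounded h) {ρ : ℝ}
    (hρ : 0 < ρ) : ∃ C, 0 ≤ C ∧
      ∀ᵐ x ∂(volume : Measure (E N)), ∀ t, |t| ≤ ρ → |h x t| ≤ C := by
  refine ⟨(essSup (fun x : E N => ⨆ t ∈ Icc (-ρ) ρ, ‖h x t‖ₑ) volume).toReal,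
    ENNReal.toReal_nonneg, ?_⟩
  filter_upwards [ENNReal.ae_le_essSup
    (fun x : E N => ⨆ t ∈ Icc (-ρ) ρ, ‖h x t‖ₑ)] with x hx t ht
  have h1 : ‖h x t‖ₑ ≤ ⨆ t ∈ Icc (-ρ) ρ, ‖h x t‖ₑ :=
    le_iSup₂ (f := fun t (_ : t ∈ Icc (-ρ) ρ) => ‖h x t‖ₑ) t (abs_le.1 ht)
  have h2 := ENNReal.toReal_mono (hh ρ hρ).ne (h1.trans hx)
  simpa using h2

/-- For `|t| ≤ ρ` one has `|t|^(q-1) = |t|^(p-1) |t|^(q-p) ≤ ρ^(q-p) |t|^(p-1)`. So no upper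
restriction on `q` is needed. -/
lemma HasGrowth.exists_bound (hp : 1 < p) {g : E N → ℝ → ℝ} (hg : HasGrowth p g) {ρ : ℝ}
    (hρ : 0 < ρ) : ∃ C, 0 ≤ C ∧
      ∀ᵐ x ∂(volume : Measure (E N)), ∀ t, |t| ≤ ρ → |g x t| ≤ C * |t| ^ (p - 1) := by
  obtain ⟨a₁, a₂, q, h1, h2, hq, hb⟩ := hg
  refine ⟨a₁ + a₂ * ρ ^ (q - p), by positivity, ?_⟩
  filter_upwards [hb] with x hx t ht
  refine (hx t).trans ?_
  have e : |t| ^ (q - 1) = |t| ^ (p - 1) * |t| ^ (q - p) := by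
    rw [← Real.rpow_add_of_nonneg (abs_nonneg _) (by linarith) (by linarith)]
    ring_nf
  have e2 : |t| ^ (q - p) ≤ ρ ^ (q - p) :=
    Real.rpow_le_rpow (abs_nonneg _) ht (by linarith)
  have e3 : 0 ≤ |t| ^ (p - 1) := by positivity
  rw [e, add_mul]
  have := mul_le_mul_of_nonneg_left e2 (mul_nonneg h2.le e3)
  nlinarith

lemma abs_primitive_le (hp : 1 < p) {g : E N → ℝ → ℝ} {x : E N} {C ρ : ℝ} (hC : 0 ≤ C)
    (h : ∀ t, |t| ≤ ρ → |g x t| ≤ C * |t| ^ (p - 1)) {t : ℝ} (ht : |t| ≤ ρ) :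
    |primitive g x t| ≤ C * |t| ^ p := by
  have h1 : ∀ s ∈ uIoc 0 t, ‖g x s‖ ≤ C * |t| ^ (p - 1) := by
    intro s hs
    have hs' : |s| ≤ |t| := by
      rcases le_total 0 t with h0 | h0
      · rw [uIoc_of_le h0] at hs
        rw [abs_of_nonneg hs.1.le, abs_of_nonneg h0]
        exact hs.2
      · rw [uIoc_of_ge h0] at hs
        rw [abs_of_nonpos hs.2, abs_of_nonpos h0]
        linarith [hs.1]
    refine (h s (hs'.trans ht)).trans (mul_le_mul_of_nonneg_left ?_ hC)
    exact Real.rpow_le_rpow (abs_nonneg _) hs' (by linarith)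
  have h2 := intervalIntegral.norm_integral_le_of_norm_le_const h1
  refine h2.trans_eq ?_
  rw [sub_zero, mul_assoc]
  congr 1
  rcases (abs_nonneg t).eq_or_lt with h0 | h0
  · rw [← h0, mul_zero, Real.zero_rpow (by linarith)]
  · rw [← Real.rpow_add_one h0.ne']
    ring_nf

lemma IsCaratheodory.ae_hasDerivAt_primitive {g : E N → ℝ → ℝ} (hg : IsCaratheodory 0 g) :
    ∀ᵐ x ∂(volume : Measure (E N)), ∀ t, HasDerivAt (primitive g x) (g x t) t := by
  filter_upwards [hg.ae_continuous] with x hx t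
  exact hx.integral_hasStrictDerivAt 0 t |>.hasDerivAt

/-- Measurability in `x` of an integral over `s` requires joint measurability of the integrand,
hence the passage to a modification. -/
lemma IsCaratheodory.primitive {g : E N → ℝ → ℝ} (hg : IsCaratheodory 0 g) :
    IsCaratheodory 0 (primitive g) where
  aemeasurable t := by
    obtain ⟨k, hk, hkg⟩ := exists_measurable_modification hg.aemeasurable hg.ae_continuous
    have hm : Measurable fun x => ∫ s in (0 : ℝ)..t, k x s := by
      simp only [intervalIntegral]
      exact (hk.stronglyMeasurable.integral_prod_right (ν := volume.restrict _)).measurable.sub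
        (hk.stronglyMeasurable.integral_prod_right (ν := volume.restrict _)).measurable
    refine hm.aemeasurable.congr ?_
    filter_upwards [hkg] with x hx
    rw [hx, WeightedSobolev.primitive]
  contDiff := by
    filter_upwards [hg.ae_hasDerivAt_primitive] with x hx
    exact contDiff_zero.2 (continuous_iff_continuousAt.2 fun t => (hx t).continuousAt)

end nonlinearities

/-! ### Linearity up to null sets and norm estimates in `X`. -/

namespace X

variable {N : ℕ} {p : ℝ} {V : E N → ℝ} {hp : 1 < p} {hV : IsPotential V}

lemma ae_abs_le (u : X hp hV) : ∀ᵐ x, |u x| ≤ u.normInfty := by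
  filter_upwards [ae_le_eLpNormEssSup (f := u) (μ := volume)] with x hx
  have h := u.memX.memLp_top.2.ne
  rw [normInfty, eLpNorm_exponent_top] at *
  simpa using ENNReal.toReal_mono h hx

lemma coe_sub (u v : X hp hV) : (u - v : X hp hV) =ᵐ[volume] fun x => u x - v x :=
  AEEqFun.coeFn_sub u.1 v.1

lemma grad_sub (u v : X hp hV) : (u - v).grad =ᵐ[volume] fun x => u.grad x - v.grad x := by
  have h : u - v = u + (-1 : ℝ) • v := by rw [neg_one_smul, sub_eq_add_neg]
  rw [h]
  filter_upwards [grad_add u ((-1 : ℝ) • v), grad_smul (-1) v] with x h1 h2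
  rw [h1, Pi.add_apply, h2, Pi.smul_apply, neg_one_smul, sub_eq_add_neg]

lemma weighted_add (u v : X hp hV) : weighted p V (u + v : X hp hV) =ᵐ[volume]
    fun x => weighted p V u x + weighted p V v x := by
  filter_upwards [coe_add u v] with x hx
  simp [weighted, hx, mul_add]

lemma weighted_smul (c : ℝ) (u : X hp hV) : weighted p V (c • u : X hp hV) =ᵐ[volume]
    fun x => c * weighted p V u x := by
  filter_upwards [coe_smul c u] with x hx
  simp only [weighted, hx]
  ring

lemma weighted_sub (u v : X hp hV) : weighted p V (u - v : X hp hV) =ᵐ[volume]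
    fun x => weighted p V u x - weighted p V v x := by
  filter_upwards [coe_sub u v] with x hx
  simp [weighted, hx, mul_sub]

lemma eLpNorm_grad_le (u : X hp hV) :
    (eLpNorm u.grad (ENNReal.ofReal p) volume).toReal ≤ u.normV := by
  rw [normV_eq, one_div, Real.le_rpow_inv_iff_of_pos ENNReal.toReal_nonneg (by positivity)
    (by linarith)]
  exact le_add_of_nonneg_right (by positivity)

lemma eLpNorm_weighted_le (u : X hp hV) :
    (eLpNorm (weighted p V u) (ENNReal.ofReal p) volume).toReal ≤ u.normV := by
  rw [normV_eq, one_div, Real.le_rpow_inv_iff_of_pos ENNReal.toReal_nonneg (by positivity)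
    (by linarith)]
  exact le_add_of_nonneg_left (by positivity)

lemma memLp (u : X hp hV) : MemLp u (ENNReal.ofReal p) volume := u.memX.memSobolev.1

-- From `V ≥ a > 0` it follows that `|u| ≤ a^(-1/p) |V^(1/p) u|` a.e.; this is where the positive
-- lower bound of the potential enters.
variable (hp hV) in
lemma exists_eLpNorm_le : ∃ c, 0 ≤ c ∧ ∀ u : X hp hV,
    (eLpNorm u (ENNReal.ofReal p) volume).toReal ≤ c * u.normV := by
  obtain ⟨a, ha, hVa⟩ := hV.exists_ae_ge
  refine ⟨a ^ (-(1 / p)), by positivity, fun u => ?_⟩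
  have hle : ∀ᵐ x, ‖u x‖ ≤ a ^ (-(1 / p)) * ‖weighted p V u x‖ := by
    filter_upwards [hVa] with x hx
    have h1 : a ^ (1 / p) ≤ V x ^ (1 / p) :=
      Real.rpow_le_rpow ha.le hx (by have : 0 < p := by linarith
                                     positivity)
    have h2 : 0 < a ^ (1 / p) := by positivity
    rw [weighted, norm_mul, ← mul_assoc, Real.rpow_neg ha.le,
      Real.norm_of_nonneg (h2.le.trans h1)]
    refine le_mul_of_one_le_left (norm_nonneg _) ?_
    rw [inv_mul_eq_div, le_div_iff₀ h2, one_mul]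
    exact h1
  have h := ENNReal.toReal_mono (ENNReal.mul_ne_top ENNReal.ofReal_ne_top u.memLp_weighted.2.ne)
    (eLpNorm_le_mul_eLpNorm_of_ae_le_mul hle (ENNReal.ofReal p))
  rw [ENNReal.toReal_mul, ENNReal.toReal_ofReal (by positivity)] at h
  exact h.trans (mul_le_mul_of_nonneg_left u.eLpNorm_weighted_le (by positivity))

lemma normV_le_norm (u : X hp hV) : u.normV ≤ ‖u‖ := by
  rw [norm_def]
  linarith [u.normInfty_nonneg]

lemma normInfty_le_norm (u : X hp hV) : u.normInfty ≤ ‖u‖ := by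
  rw [norm_def]
  linarith [u.normV_nonneg]

end X

/-! ### Functionals on `X` represented by densities. -/

section dual

variable {N : ℕ} {p : ℝ} {V : E N → ℝ} {hp : 1 < p} {hV : IsPotential V}

/-- Densities representing the linear functional
`v ↦ ∫ ⟨a, ∇v⟩ + ∫ b v + ∫ c V^(1/p) v + ∫ d v` on `X`. -/
structure DualDensity (N : ℕ) where
  a : E N → E N
  b : E N → ℝ
  c : E N → ℝ
  d : E N → ℝ

namespace DualDensity

/-- The densities lie in the spaces dual to those of `∇v`, `v`, `V^(1/p) v` and `v`. -/
structure Mem (p : ℝ) (D : DualDensity N) : Prop where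
  a : MemLp D.a (ENNReal.ofReal (p / (p - 1))) volume
  b : MemLp D.b (ENNReal.ofReal 1) volume
  c : MemLp D.c (ENNReal.ofReal (p / (p - 1))) volume
  d : MemLp D.d (ENNReal.ofReal (p / (p - 1))) volume

instance : Sub (DualDensity N) := ⟨fun D D' => ⟨fun x => D.a x - D'.a x, fun x => D.b x - D'.b x,
  fun x => D.c x - D'.c x, fun x => D.d x - D'.d x⟩⟩

/-- The sum of the dual norms of the densities. -/
noncomputable def size (p : ℝ) (D : DualDensity N) : ℝ :=
  (eLpNorm D.a (ENNReal.ofReal (p / (p - 1))) volume).toReal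
    + (eLpNorm D.b (ENNReal.ofReal 1) volume).toReal
    + (eLpNorm D.c (ENNReal.ofReal (p / (p - 1))) volume).toReal
    + (eLpNorm D.d (ENNReal.ofReal (p / (p - 1))) volume).toReal

/-- The functional represented by the densities. -/
noncomputable def pair (D : DualDensity N) (v : X hp hV) : ℝ :=
  (∫ x, inner ℝ (D.a x) (v.grad x)) + (∫ x, D.b x * v x) + (∫ x, D.c x * weighted p V v x)
    + ∫ x, D.d x * v x

lemma Mem.sub {D D' : DualDensity N} (h : D.Mem p) (h' : D'.Mem p) : (D - D').Mem p where
  a := h.a.sub h'.a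
  b := h.b.sub h'.b
  c := h.c.sub h'.c
  d := h.d.sub h'.d

lemma size_nonneg (D : DualDensity N) : 0 ≤ D.size p := by
  rw [size]
  positivity

lemma holderTriple_conj (hp : 1 < p) :
    ENNReal.HolderTriple (ENNReal.ofReal (p / (p - 1))) (ENNReal.ofReal p) 1 where
  inv_add_inv_eq_inv := by
    have h1 : 0 < p - 1 := by linarith
    have h2 : 0 < p := by linarith
    rw [← ENNReal.ofReal_inv_of_pos (by positivity), ← ENNReal.ofReal_inv_of_pos h2,
      ← ENNReal.ofReal_add (by positivity) (by positivity), inv_one, ← ENNReal.ofReal_one]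
    congr 1
    field_simp
    ring

lemma Mem.a_pair {D : DualDensity N} (h : D.Mem p) (v : X hp hV) :
    Integrable (fun x => inner ℝ (D.a x) (v.grad x)) volume ∧
      |∫ x, inner ℝ (D.a x) (v.grad x)| ≤
        (eLpNorm D.a (ENNReal.ofReal (p / (p - 1))) volume).toReal
          * (eLpNorm v.grad (ENNReal.ofReal p) volume).toReal :=
  have := holderTriple_conj hp
  integrable_pairing (b := fun y z => inner ℝ y z) (fun y z => norm_inner_le_norm y z)
    h.a v.memLp_grad (h.a.1.inner v.memLp_grad.1)

lemma Mem.b_pair {D : DualDensity N} (h : D.Mem p) (v : X hp hV) :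
    Integrable (fun x => D.b x * v x) volume ∧
      |∫ x, D.b x * v x| ≤
        (eLpNorm D.b (ENNReal.ofReal 1) volume).toReal * v.normInfty := by
  have h' := h.b
  rw [ENNReal.ofReal_one] at h' ⊢
  exact integrable_pairing (b := fun y z => y * z) (fun y z => (norm_mul y z).le)
    h' v.memX.memLp_top (h'.1.mul v.memX.memLp_top.1)

lemma Mem.c_pair {D : DualDensity N} (h : D.Mem p) (v : X hp hV) :
    Integrable (fun x => D.c x * weighted p V v x) volume ∧
      |∫ x, D.c x * weighted p V v x| ≤
        (eLpNorm D.c (ENNReal.ofReal (p / (p - 1))) volume).toReal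
          * (eLpNorm (weighted p V v) (ENNReal.ofReal p) volume).toReal :=
  have := holderTriple_conj hp
  integrable_pairing (b := fun y z => y * z) (fun y z => (norm_mul y z).le)
    h.c v.memLp_weighted (h.c.1.mul v.memLp_weighted.1)

lemma Mem.d_pair {D : DualDensity N} (h : D.Mem p) (v : X hp hV) :
    Integrable (fun x => D.d x * v x) volume ∧
      |∫ x, D.d x * v x| ≤
        (eLpNorm D.d (ENNReal.ofReal (p / (p - 1))) volume).toReal
          * (eLpNorm v (ENNReal.ofReal p) volume).toReal :=
  have := holderTriple_conj hp
  integrable_pairing (b := fun y z => y * z) (fun y z => (norm_mul y z).le)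
    h.d v.memLp (h.d.1.mul v.memLp.1)

-- Hölder's inequality in each of the four terms. The constant does not depend on `D`, so small
-- densities give a functional of small operator norm. The summand `1` serves the norms of `∇v`,
-- `V^(1/p) v` and `|v|_∞`, and `c` serves the `L^p` norm of `v`.
variable (hp hV) in
lemma exists_abs_pair_le : ∃ K, 0 ≤ K ∧ ∀ D : DualDensity N, D.Mem p → ∀ v : X hp hV,
    |D.pair v| ≤ K * D.size p * ‖v‖ := by
  obtain ⟨c, hc, hcv⟩ := X.exists_eLpNorm_le hp hV
  refine ⟨1 + c, by positivity, fun D hD v => ?_⟩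
  have hv := norm_nonneg v
  have bound : ∀ m t : ℝ, 0 ≤ m → t ≤ (1 + c) * ‖v‖ → m * t ≤ m * ((1 + c) * ‖v‖) :=
    fun m t hm ht => mul_le_mul_of_nonneg_left ht hm
  have hcv' := mul_nonneg hc hv
  have ha := bound (eLpNorm D.a (ENNReal.ofReal (p / (p - 1))) volume).toReal _
    ENNReal.toReal_nonneg
    (by linarith [v.eLpNorm_grad_le, v.normV_le_norm] :
      (eLpNorm v.grad (ENNReal.ofReal p) volume).toReal ≤ (1 + c) * ‖v‖)
  have hb := bound (eLpNorm D.b (ENNReal.ofReal 1) volume).toReal _ ENNReal.toReal_nonneg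
    (by linarith [v.normInfty_le_norm] : v.normInfty ≤ (1 + c) * ‖v‖)
  have hc' := bound (eLpNorm D.c (ENNReal.ofReal (p / (p - 1))) volume).toReal _
    ENNReal.toReal_nonneg
    (by linarith [v.eLpNorm_weighted_le, v.normV_le_norm] :
      (eLpNorm (weighted p V v) (ENNReal.ofReal p) volume).toReal ≤ (1 + c) * ‖v‖)
  have hd := bound (eLpNorm D.d (ENNReal.ofReal (p / (p - 1))) volume).toReal _
    ENNReal.toReal_nonneg
    (by linarith [hcv v, mul_le_mul_of_nonneg_left v.normV_le_norm hc] :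
      (eLpNorm v (ENNReal.ofReal p) volume).toReal ≤ (1 + c) * ‖v‖)
  rw [pair, size]
  refine (abs_add_le _ _).trans ((add_le_add_left (abs_add_three _ _ _) _).trans ?_)
  linarith [(hD.a_pair v).2, (hD.b_pair v).2, (hD.c_pair v).2, (hD.d_pair v).2]

lemma Mem.pair_add {D : DualDensity N} (h : D.Mem p) (v w : X hp hV) :
    D.pair (v + w) = D.pair v + D.pair w := by
  have ha : ∫ x, inner ℝ (D.a x) ((v + w).grad x) =
      (∫ x, inner ℝ (D.a x) (v.grad x)) + ∫ x, inner ℝ (D.a x) (w.grad x) := by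
    rw [← integral_add (h.a_pair v).1 (h.a_pair w).1]
    refine integral_congr_ae ?_
    filter_upwards [X.grad_add v w] with x hx
    rw [hx, Pi.add_apply, inner_add_right]
  have hb : ∫ x, D.b x * (v + w) x = (∫ x, D.b x * v x) + ∫ x, D.b x * w x := by
    rw [← integral_add (h.b_pair v).1 (h.b_pair w).1]
    refine integral_congr_ae ?_
    filter_upwards [X.coe_add v w] with x hx
    rw [hx, mul_add]
  have hc : ∫ x, D.c x * weighted p V (v + w : X hp hV) x =
      (∫ x, D.c x * weighted p V v x) + ∫ x, D.c x * weighted p V w x := by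
    rw [← integral_add (h.c_pair v).1 (h.c_pair w).1]
    refine integral_congr_ae ?_
    filter_upwards [X.weighted_add v w] with x hx
    rw [hx, mul_add]
  have hd : ∫ x, D.d x * (v + w) x = (∫ x, D.d x * v x) + ∫ x, D.d x * w x := by
    rw [← integral_add (h.d_pair v).1 (h.d_pair w).1]
    refine integral_congr_ae ?_
    filter_upwards [X.coe_add v w] with x hx
    rw [hx, mul_add]
  rw [pair, ha, hb, hc, hd, pair, pair]
  ring

lemma pair_smul (D : DualDensity N) (t : ℝ) (v : X hp hV) : D.pair (t • v) = t * D.pair v := by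
  have ha : ∫ x, inner ℝ (D.a x) ((t • v).grad x) = t * ∫ x, inner ℝ (D.a x) (v.grad x) := by
    rw [← integral_const_mul]
    refine integral_congr_ae ?_
    filter_upwards [X.grad_smul t v] with x hx
    rw [hx, Pi.smul_apply, real_inner_smul_right]
  have hb : ∀ f : E N → ℝ, ∫ x, f x * (t • v) x = t * ∫ x, f x * v x := by
    intro f
    rw [← integral_const_mul]
    refine integral_congr_ae ?_
    filter_upwards [X.coe_smul t v] with x hx
    rw [hx, mul_left_comm]
  have hc : ∫ x, D.c x * weighted p V (t • v : X hp hV) x =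
      t * ∫ x, D.c x * weighted p V v x := by
    rw [← integral_const_mul]
    refine integral_congr_ae ?_
    filter_upwards [X.weighted_smul t v] with x hx
    rw [hx, mul_left_comm]
  rw [pair, ha, hb, hc, hb, pair]
  ring

lemma Mem.pair_sub {D D' : DualDensity N} (h : D.Mem p) (h' : D'.Mem p) (v : X hp hV) :
    (D - D').pair v = D.pair v - D'.pair v := by
  have ha : ∫ x, inner ℝ ((D - D').a x) (v.grad x) =
      (∫ x, inner ℝ (D.a x) (v.grad x)) - ∫ x, inner ℝ (D'.a x) (v.grad x) := by
    rw [← integral_sub (h.a_pair v).1 (h'.a_pair v).1]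
    exact integral_congr_ae (ae_of_all _ fun x => inner_sub_left _ _ _)
  have hb : ∫ x, (D - D').b x * v x = (∫ x, D.b x * v x) - ∫ x, D'.b x * v x := by
    rw [← integral_sub (h.b_pair v).1 (h'.b_pair v).1]
    exact integral_congr_ae (ae_of_all _ fun x => sub_mul _ _ _)
  have hc : ∫ x, (D - D').c x * weighted p V v x =
      (∫ x, D.c x * weighted p V v x) - ∫ x, D'.c x * weighted p V v x := by
    rw [← integral_sub (h.c_pair v).1 (h'.c_pair v).1]
    exact integral_congr_ae (ae_of_all _ fun x => sub_mul _ _ _)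
  have hd : ∫ x, (D - D').d x * v x = (∫ x, D.d x * v x) - ∫ x, D'.d x * v x := by
    rw [← integral_sub (h.d_pair v).1 (h'.d_pair v).1]
    exact integral_congr_ae (ae_of_all _ fun x => sub_mul _ _ _)
  rw [pair, ha, hb, hc, hd, pair, pair]
  ring

/-- The continuous linear functional represented by the densities. -/
noncomputable def toDual (D : DualDensity N) (h : D.Mem p) : X hp hV →L[ℝ] ℝ :=
  LinearMap.mkContinuousOfExistsBound
    { toFun := D.pair
      map_add' := h.pair_add
      map_smul' := D.pair_smul }
    (by
      obtain ⟨K, -, hK⟩ := exists_abs_pair_le hp hV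
      exact ⟨K * D.size p, hK D h⟩)

@[simp]
lemma toDual_apply (D : DualDensity N) (h : D.Mem p) (v : X hp hV) :
    D.toDual h v = D.pair v := rfl

lemma tendsto_norm_toDual_sub {Dn : ℕ → DualDensity N} {D : DualDensity N}
    (hn : ∀ n, (Dn n).Mem p) (h : D.Mem p)
    (hlim : Tendsto (fun n => (Dn n - D).size p) atTop (𝓝 0)) :
    Tendsto (fun n => ‖((Dn n).toDual (hn n) - D.toDual h : X hp hV →L[ℝ] ℝ)‖) atTop (𝓝 0) := by
  obtain ⟨K, hK0, hK⟩ := exists_abs_pair_le hp hV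
  have h0 := hlim.const_mul K
  rw [mul_zero] at h0
  refine squeeze_zero (fun n => norm_nonneg _) (fun n => ?_) h0
  refine ContinuousLinearMap.opNorm_le_bound _ (mul_nonneg hK0 (size_nonneg _)) fun v => ?_
  rw [sub_apply, toDual_apply, toDual_apply, ← (hn n).pair_sub h]
  exact hK _ ((hn n).sub h) v

end DualDensity

end dual

/-! ### The densities of `dJ(u)`, absolute convergence of the integrals, and continuity. -/

section convergence

variable {N : ℕ} {p : ℝ} {V : E N → ℝ} {hp : 1 < p} {hV : IsPotential V} {A g : E N → ℝ → ℝ}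

/-- The assumptions on the coefficients `A` and `g`. -/
structure Admissible (p : ℝ) (A g : E N → ℝ → ℝ) : Prop where
  coeff : IsCaratheodory 1 A
  coeff_bdd : LocallyEssBounded A
  partialT_bdd : LocallyEssBounded (partialT A)
  source : IsCaratheodory 0 g
  growth : HasGrowth p g

lemma Admissible.exists_bound (h : Admissible p A g) (hp : 1 < p) {ρ : ℝ} (hρ : 0 < ρ) :
    ∃ C, 0 ≤ C ∧ ∀ᵐ x ∂(volume : Measure (E N)), ∀ t, |t| ≤ ρ → |A x t| ≤ C ∧
      |partialT A x t| ≤ C ∧ |g x t| ≤ C * |t| ^ (p - 1) ∧ |primitive g x t| ≤ C * |t| ^ p := by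
  obtain ⟨C₁, h₁, hC₁⟩ := h.coeff_bdd.exists_bound hρ
  obtain ⟨C₂, h₂, hC₂⟩ := h.partialT_bdd.exists_bound hρ
  obtain ⟨C₃, h₃, hC₃⟩ := h.growth.exists_bound hp hρ
  refine ⟨C₁ + C₂ + C₃, by positivity, ?_⟩
  filter_upwards [hC₁, hC₂, hC₃] with x e₁ e₂ e₃ t ht
  have hle : C₃ ≤ C₁ + C₂ + C₃ := by linarith
  refine ⟨by linarith [e₁ t ht], by linarith [e₂ t ht], ?_, ?_⟩
  · exact (e₃ t ht).trans (mul_le_mul_of_nonneg_right hle (by positivity))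
  · exact (abs_primitive_le hp h₃ e₃ ht).trans (mul_le_mul_of_nonneg_right hle (by positivity))

/-- The densities of `dJ(u)`. -/
noncomputable def diffDensity (A g : E N → ℝ → ℝ) (u : X hp hV) : DualDensity N where
  a x := A x (u x) • (‖u.grad x‖ ^ (p - 2) • u.grad x)
  b x := 1 / p * (partialT A x (u x) * ‖u.grad x‖ ^ p)
  c x := ‖weighted p V u x‖ ^ (p - 2) • weighted p V u x
  d x := -g x (u x)

lemma norm_diffDensity_le (u : X hp hV) {ρ C : ℝ} (hu : ∀ᵐ x, |u x| ≤ ρ)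
    (hb : ∀ᵐ x ∂(volume : Measure (E N)), ∀ t, |t| ≤ ρ → |A x t| ≤ C ∧
      |partialT A x t| ≤ C ∧ |g x t| ≤ C * |t| ^ (p - 1) ∧ |primitive g x t| ≤ C * |t| ^ p) :
    ∀ᵐ x, ‖(diffDensity A g u).a x‖ ≤ C * ‖u.grad x‖ ^ (p - 1) ∧
      ‖(diffDensity A g u).b x‖ ≤ C * ‖u.grad x‖ ^ p ∧
      ‖(diffDensity A g u).d x‖ ≤ C * ‖u x‖ ^ (p - 1) ∧
      ‖A x (u x) * ‖u.grad x‖ ^ p‖ ≤ C * ‖u.grad x‖ ^ p ∧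
      ‖primitive g x (u x)‖ ≤ C * ‖u x‖ ^ p := by
  filter_upwards [hu, hb] with x hx hbx
  obtain ⟨h1, h2, h3, h4⟩ := hbx _ hx
  have hr : ‖‖u.grad x‖ ^ p‖ = ‖u.grad x‖ ^ p := Real.norm_of_nonneg (by positivity)
  refine ⟨?_, ?_, ?_, ?_, h4⟩
  · rw [diffDensity, norm_smul, norm_rpow_sub_two_smul hp]
    exact mul_le_mul_of_nonneg_right h1 (by positivity)
  · have h1p : ‖1 / p‖ ≤ 1 := by
      rw [Real.norm_of_nonneg (by have : 0 < p := by linarith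
                                  positivity), div_le_one (by linarith)]
      exact hp.le
    rw [diffDensity, norm_mul, norm_mul, hr]
    refine (mul_le_of_le_one_left (by positivity) h1p).trans ?_
    exact mul_le_mul_of_nonneg_right h2 (by positivity)
  · rw [diffDensity, norm_neg]
    exact h3
  · rw [norm_mul, hr]
    exact mul_le_mul_of_nonneg_right h1 (by positivity)

lemma norm_diffDensity_c (u : X hp hV) (x : E N) :
    ‖(diffDensity A g u).c x‖ ≤ 1 * ‖weighted p V u x‖ ^ (p - 1) := by
  rw [one_mul]
  exact (norm_rpow_sub_two_smul hp _).le

lemma X.aemeasurable (u : X hp hV) : AEMeasurable u volume := u.memX.memLp_top.1.aemeasurable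

lemma X.aestronglyMeasurable_rpow (u : X hp hV) :
    AEStronglyMeasurable (fun x => ‖u.grad x‖ ^ p) volume :=
  (u.memLp_grad.1.norm.aemeasurable.pow_const p).aestronglyMeasurable

lemma IsCaratheodory.aestronglyMeasurable {k : ℕ} {h : E N → ℝ → ℝ} (hh : IsCaratheodory k h)
    (u : X hp hV) : AEStronglyMeasurable (fun x => h x (u x)) volume :=
  (aemeasurable_superposition hh.aemeasurable hh.ae_continuous u.aemeasurable).aestronglyMeasurable

lemma Admissible.aestronglyMeasurable_a (h : Admissible p A g) (u : X hp hV) :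
    AEStronglyMeasurable (diffDensity A g u).a volume :=
  (h.coeff.aestronglyMeasurable u).smul
    ((continuous_rpow_sub_two_smul hp).comp_aestronglyMeasurable u.memLp_grad.1)

lemma Admissible.aestronglyMeasurable_b (h : Admissible p A g) (u : X hp hV) :
    AEStronglyMeasurable (diffDensity A g u).b volume :=
  ((h.coeff.partialT.aestronglyMeasurable u).mul u.aestronglyMeasurable_rpow).const_mul _

lemma aestronglyMeasurable_c (u : X hp hV) :
    AEStronglyMeasurable (diffDensity A g u).c volume :=
  (continuous_rpow_sub_two_smul hp).comp_aestronglyMeasurable u.memLp_weighted.1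

lemma Admissible.aestronglyMeasurable_d (h : Admissible p A g) (u : X hp hV) :
    AEStronglyMeasurable (diffDensity A g u).d volume :=
  (h.source.aestronglyMeasurable u).neg

lemma Admissible.aestronglyMeasurable_energy (h : Admissible p A g) (u : X hp hV) :
    AEStronglyMeasurable (fun x => A x (u x) * ‖u.grad x‖ ^ p) volume :=
  (h.coeff.aestronglyMeasurable u).mul u.aestronglyMeasurable_rpow

lemma sub_one_mul_conj (hp : 1 < p) : (p - 1) * (p / (p - 1)) = p := by
  have : p - 1 ≠ 0 := by linarith
  field_simp

lemma Admissible.mem_diffDensity (h : Admissible p A g) (u : X hp hV) :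
    (diffDensity A g u).Mem p ∧
      Integrable (fun x => A x (u x) * ‖u.grad x‖ ^ p) volume ∧
      Integrable (fun x => primitive g x (u x)) volume := by
  -- The added `1` keeps the radius positive when `u = 0`.
  obtain ⟨C, hC, hb⟩ := h.exists_bound hp (ρ := u.normInfty + 1)
    (by linarith [u.normInfty_nonneg])
  have hn := norm_diffDensity_le u (u.ae_abs_le.mono fun x hx => by linarith) hb
  have hs : 0 < p - 1 := by linarith
  have hp0 : 0 < p := by linarith
  have hconj := sub_one_mul_conj hp
  refine ⟨⟨?_, ?_, ?_, ?_⟩, ?_, ?_⟩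
  · exact memLp_of_norm_le_rpow hs hconj u.memLp_grad (h.aestronglyMeasurable_a u)
      (hn.mono fun x hx => hx.1)
  · exact memLp_of_norm_le_rpow hp0 (mul_one p) u.memLp_grad (h.aestronglyMeasurable_b u)
      (hn.mono fun x hx => hx.2.1)
  · exact memLp_of_norm_le_rpow hs hconj u.memLp_weighted (aestronglyMeasurable_c u)
      (ae_of_all _ (norm_diffDensity_c u))
  · exact memLp_of_norm_le_rpow hs hconj u.memLp (h.aestronglyMeasurable_d u)
      (hn.mono fun x hx => hx.2.2.1)
  · rw [← memLp_one_iff_integrable, ← ENNReal.ofReal_one]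
    exact memLp_of_norm_le_rpow hp0 (mul_one p) u.memLp_grad (h.aestronglyMeasurable_energy u)
      (hn.mono fun x hx => hx.2.2.2.1)
  · rw [← memLp_one_iff_integrable, ← ENNReal.ofReal_one]
    exact memLp_of_norm_le_rpow hp0 (mul_one p) u.memLp
      (h.source.primitive.aestronglyMeasurable u) (hn.mono fun x hx => hx.2.2.2.2)

/-- The weight is shared between the factors: the exponents of `V` are `(p-2)/p`, `1/p` and `1/p`,
with sum `1`. -/
lemma diffDensity_c_mul_ae (u v : X hp hV) :
    (fun x => (diffDensity A g u).c x * weighted p V v x) =ᵐ[volume]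
      fun x => V x * |u x| ^ (p - 2) * u x * v x := by
  filter_upwards [hV.ae_pos] with x hx
  have h1 : 0 ≤ V x ^ (1 / p) := by positivity
  have h2 : (V x ^ (1 / p)) ^ (p - 2) * V x ^ (1 / p) * V x ^ (1 / p) = V x := by
    rw [← Real.rpow_mul hx.le, ← Real.rpow_add hx, ← Real.rpow_add hx]
    have : 1 / p * (p - 2) + 1 / p + 1 / p = 1 := by
      have : p ≠ 0 := by linarith
      field_simp
      ring
    rw [this, Real.rpow_one]
  simp only [diffDensity, weighted, smul_eq_mul]
  rw [norm_mul, Real.norm_of_nonneg h1, Real.norm_eq_abs, Real.mul_rpow h1 (abs_nonneg _)]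
  linear_combination (|u x| ^ (p - 2) * u x * v x) * h2

lemma Admissible.integralsConverge (h : Admissible p A g) (u v : X hp hV) :
    IntegralsConverge A g u v := by
  obtain ⟨hm, h1, h2⟩ := h.mem_diffDensity u
  have hp0 : p ≠ 0 := by linarith
  refine ⟨h1, u.memX.integrable_weight, h2, ?_, ?_, ?_, ?_⟩
  · refine (hm.a_pair v).1.congr (ae_of_all _ fun x => ?_)
    simp only [diffDensity, real_inner_smul_left]
    ring
  · refine ((hm.b_pair v).1.const_mul p).congr (ae_of_all _ fun x => ?_)
    simp only [diffDensity]
    field_simp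
  · exact (hm.c_pair v).1.congr (diffDensity_c_mul_ae u v)
  · refine (hm.d_pair v).1.neg.congr (ae_of_all _ fun x => ?_)
    simp [diffDensity]

lemma pair_diffDensity (u v : X hp hV) :
    (diffDensity A g u).pair v = diffEnergy A g u v := by
  rw [DualDensity.pair, diffEnergy, integral_congr_ae (diffDensity_c_mul_ae u v),
    ← integral_const_mul, sub_eq_add_neg (_ + _ + _), ← integral_neg]
  congr 1
  · congr 1
    congr 1
    · congr 1
      ext x
      simp only [diffDensity, real_inner_smul_left]
      ring
    · congr 1
      ext x
      simp only [diffDensity]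
      ring
  · congr 1
    ext x
    simp only [diffDensity]
    ring

/-- The differential of `J` at `u` as a continuous linear functional. -/
noncomputable def differential (h : Admissible p A g) (u : X hp hV) : X hp hV →L[ℝ] ℝ :=
  (diffDensity A g u).toDual (h.mem_diffDensity u).1

lemma differential_apply (h : Admissible p A g) (u v : X hp hV) :
    differential h u v = diffEnergy A g u v :=
  pair_diffDensity u v

lemma X.tendsto_eLpNorm {F : Type*} [NormedAddCommGroup F] {q : ℝ≥0∞} {f : ℕ → E N → F}
    {u : ℕ → X hp hV} {c : ℝ} (hf : ∀ n, eLpNorm (f n) q volume ≠ ⊤)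
    (hle : ∀ n, (eLpNorm (f n) q volume).toReal ≤ c * (u n).normV)
    (hu : Tendsto (fun n => (u n).normV) atTop (𝓝 0)) :
    Tendsto (fun n => eLpNorm (f n) q volume) atTop (𝓝 0) := by
  rw [← ENNReal.tendsto_toReal_iff hf ENNReal.zero_ne_top, ENNReal.toReal_zero]
  have := hu.const_mul c
  rw [mul_zero] at this
  exact squeeze_zero (fun n => ENNReal.toReal_nonneg) hle this

lemma X.tendsto_eLpNorm_grad_sub {u_ : ℕ → X hp hV} {u : X hp hV}
    (hu : Tendsto (fun n => (u_ n - u).normV) atTop (𝓝 0)) :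
    Tendsto (fun n => eLpNorm (fun x => (u_ n).grad x - u.grad x) (ENNReal.ofReal p) volume)
      atTop (𝓝 0) := by
  have e := fun n => eLpNorm_congr_ae (p := ENNReal.ofReal p) (X.grad_sub (u_ n) u)
  simp_rw [← e]
  refine X.tendsto_eLpNorm (c := 1) (fun n => (u_ n - u).memLp_grad.2.ne) (fun n => ?_) hu
  rw [one_mul]
  exact (u_ n - u).eLpNorm_grad_le

lemma X.tendsto_eLpNorm_weighted_sub {u_ : ℕ → X hp hV} {u : X hp hV}
    (hu : Tendsto (fun n => (u_ n - u).normV) atTop (𝓝 0)) :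
    Tendsto (fun n => eLpNorm (fun x => weighted p V (u_ n) x - weighted p V u x)
      (ENNReal.ofReal p) volume) atTop (𝓝 0) := by
  have e := fun n => eLpNorm_congr_ae (p := ENNReal.ofReal p) (X.weighted_sub (u_ n) u)
  simp_rw [← e]
  refine X.tendsto_eLpNorm (c := 1) (fun n => (u_ n - u).memLp_weighted.2.ne) (fun n => ?_) hu
  rw [one_mul]
  exact (u_ n - u).eLpNorm_weighted_le

lemma X.tendsto_eLpNorm_coe_sub {u_ : ℕ → X hp hV} {u : X hp hV}
    (hu : Tendsto (fun n => (u_ n - u).normV) atTop (𝓝 0)) :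
    Tendsto (fun n => eLpNorm (fun x => u_ n x - u x) (ENNReal.ofReal p) volume)
      atTop (𝓝 0) := by
  have e := fun n => eLpNorm_congr_ae (p := ENNReal.ofReal p) (X.coe_sub (u_ n) u)
  simp_rw [← e]
  obtain ⟨c, -, hc⟩ := X.exists_eLpNorm_le hp hV
  exact X.tendsto_eLpNorm (fun n => (u_ n - u).memLp.2.ne) (fun n => hc _) hu

lemma energy_eq (u : X hp hV) : energy A g u = 1 / p * (∫ x, A x (u x) * ‖u.grad x‖ ^ p)
    + 1 / p * (∫ x, ‖weighted p V u x‖ ^ p) - ∫ x, primitive g x (u x) := by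
  rw [energy, integral_congr_ae (weighted_rpow hp hV u)]

lemma X.integrable_weighted_rpow (u : X hp hV) :
    Integrable (fun x => ‖weighted p V u x‖ ^ p) volume :=
  u.memX.integrable_weight.congr (weighted_rpow hp hV u).symm

/-- Convergence of the energy and of its differential when the gradients converge a.e. -/
lemma Admissible.tendsto_of_ae_tendsto_grad (h : Admissible p A g) {u_ : ℕ → X hp hV}
    {u : X hp hV} {M : ℝ} (hM : 0 < M)
    (hae : ∀ᵐ x, Tendsto (fun n => u_ n x) atTop (𝓝 (u x)))
    (hgrad : ∀ᵐ x, Tendsto (fun n => (u_ n).grad x) atTop (𝓝 (u.grad x)))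
    (hu : Tendsto (fun n => (u_ n - u).normV) atTop (𝓝 0))
    (hbd : ∀ n, (u_ n).normInfty ≤ M) :
    Tendsto (fun n => energy A g (u_ n)) atTop (𝓝 (energy A g u)) ∧
      Tendsto (fun n => ‖differential h (u_ n) - differential h u‖) atTop (𝓝 0) := by
  have hs : 0 < p - 1 := by linarith
  have hp0 : 0 < p := by linarith
  have hr : 0 < p / (p - 1) := by positivity
  have hconj := sub_one_mul_conj hp
  have hnn := u.normInfty_nonneg
  -- This radius covers the limit and all members of the sequence, so one `C` serves them all.
  obtain ⟨C, hC, hb⟩ := h.exists_bound hp (ρ := u.normInfty + M) (by linarith)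
  have hn := norm_diffDensity_le u (u.ae_abs_le.mono fun x hx => by linarith) hb
  have hnn := fun n => norm_diffDensity_le (u_ n)
    ((u_ n).ae_abs_le.mono fun x hx => by linarith [hbd n]) hb
  have gr := X.tendsto_eLpNorm_grad_sub hu
  have we := X.tendsto_eLpNorm_weighted_sub hu
  have co := X.tendsto_eLpNorm_coe_sub hu
  have hw : ∀ᵐ x, Tendsto (fun n => weighted p V (u_ n) x) atTop (𝓝 (weighted p V u x)) := by
    filter_upwards [hae] with x hx using hx.const_mul _
  have comp : ∀ {k : ℕ} {f : E N → ℝ → ℝ}, IsCaratheodory k f →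
      ∀ᵐ x, Tendsto (fun n => f x (u_ n x)) atTop (𝓝 (f x (u x))) := by
    intro k f hf
    filter_upwards [hf.ae_continuous, hae] with x h1 h2 using (h1.tendsto _).comp h2
  have hgp : ∀ᵐ x, Tendsto (fun n => ‖(u_ n).grad x‖ ^ p) atTop (𝓝 (‖u.grad x‖ ^ p)) := by
    filter_upwards [hgrad] with x hx using hx.norm.rpow_const (Or.inr hp0.le)
  have hm := fun n => h.mem_diffDensity (u_ n)
  have hm0 := h.mem_diffDensity u
  constructor
  · simp_rw [energy_eq]
    refine ((Tendsto.const_mul _ ?_).add (Tendsto.const_mul _ ?_)).sub ?_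
    · refine tendsto_integral_of_tendsto_eLpNorm_one hm0.2.1 (fun n => (hm n).2.1) ?_
      refine tendsto_eLpNorm_sub_of_norm_le_rpow one_pos hp0 (mul_one p) hC u.memLp_grad gr
        (h.aestronglyMeasurable_energy u) (fun n => h.aestronglyMeasurable_energy (u_ n))
        (hn.mono fun x hx => hx.2.2.2.1) (fun n => (hnn n).mono fun x hx => hx.2.2.2.1) ?_
      filter_upwards [comp h.coeff, hgp] with x h1 h2 using h1.mul h2
    · refine tendsto_integral_of_tendsto_eLpNorm_one u.integrable_weighted_rpow
        (fun n => (u_ n).integrable_weighted_rpow) ?_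
      refine tendsto_eLpNorm_sub_of_norm_le_rpow one_pos hp0 (mul_one p) zero_le_one
        u.memLp_weighted we u.integrable_weighted_rpow.1
        (fun n => (u_ n).integrable_weighted_rpow.1)
        (ae_of_all _ fun x => ?_) (fun n => ae_of_all _ fun x => ?_) ?_
      · rw [one_mul, Real.norm_of_nonneg (by positivity)]
      · rw [one_mul, Real.norm_of_nonneg (by positivity)]
      · filter_upwards [hw] with x hx using hx.norm.rpow_const (Or.inr hp0.le)
    · refine tendsto_integral_of_tendsto_eLpNorm_one hm0.2.2 (fun n => (hm n).2.2) ?_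
      exact tendsto_eLpNorm_sub_of_norm_le_rpow one_pos hp0 (mul_one p) hC u.memLp co
        (h.source.primitive.aestronglyMeasurable u)
        (fun n => h.source.primitive.aestronglyMeasurable (u_ n))
        (hn.mono fun x hx => hx.2.2.2.2) (fun n => (hnn n).mono fun x hx => hx.2.2.2.2)
        (comp h.source.primitive)
  · refine DualDensity.tendsto_norm_toDual_sub (fun n => (hm n).1) hm0.1 ?_
    have toReal : ∀ {f : ℕ → ℝ≥0∞}, Tendsto f atTop (𝓝 0) →
        Tendsto (fun n => (f n).toReal) atTop (𝓝 0) := fun hf => by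
      simpa [Function.comp_def] using (ENNReal.tendsto_toReal ENNReal.zero_ne_top).comp hf
    have key : Tendsto (fun n => (diffDensity A g (u_ n) - diffDensity A g u).size p) atTop
        (𝓝 (0 + 0 + 0 + 0)) := by
      refine (((toReal ?_).add (toReal ?_)).add (toReal ?_)).add (toReal ?_)
      · refine tendsto_eLpNorm_sub_of_norm_le_rpow hr hs hconj hC u.memLp_grad gr
          hm0.1.a.1 (fun n => (hm n).1.a.1)
          (hn.mono fun x hx => hx.1) (fun n => (hnn n).mono fun x hx => hx.1) ?_
        filter_upwards [comp h.coeff, hgrad] with x h1 h2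
        exact h1.smul (((continuous_rpow_sub_two_smul hp).tendsto _).comp h2)
      · refine tendsto_eLpNorm_sub_of_norm_le_rpow one_pos hp0 (mul_one p) hC u.memLp_grad gr
          hm0.1.b.1 (fun n => (hm n).1.b.1)
          (hn.mono fun x hx => hx.2.1) (fun n => (hnn n).mono fun x hx => hx.2.1) ?_
        filter_upwards [comp h.coeff.partialT, hgp] with x h1 h2
        exact (h1.mul h2).const_mul _
      · refine tendsto_eLpNorm_sub_of_norm_le_rpow hr hs hconj zero_le_one u.memLp_weighted we
          hm0.1.c.1 (fun n => (hm n).1.c.1)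
          (ae_of_all _ (norm_diffDensity_c u)) (fun n => ae_of_all _ (norm_diffDensity_c _)) ?_
        filter_upwards [hw] with x hx
        exact ((continuous_rpow_sub_two_smul hp).tendsto _).comp hx
      · refine tendsto_eLpNorm_sub_of_norm_le_rpow hr hs hconj hC u.memLp co
          hm0.1.d.1 (fun n => (hm n).1.d.1)
          (hn.mono fun x hx => hx.2.2.1) (fun n => (hnn n).mono fun x hx => hx.2.2.1) ?_
        filter_upwards [comp h.source] with x hx using hx.neg
    simpa using key

/-- Convergence of the energy and of its differential along bounded sequences that converge
a.e. and in the norm `‖·‖_V`. -/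
lemma Admissible.tendsto_energy_differential (h : Admissible p A g) {u_ : ℕ → X hp hV}
    {u : X hp hV} {M : ℝ} (hM : 0 < M)
    (hae : ∀ᵐ x, Tendsto (fun n => u_ n x) atTop (𝓝 (u x)))
    (hu : Tendsto (fun n => (u_ n - u).normV) atTop (𝓝 0))
    (hbd : ∀ n, (u_ n).normInfty ≤ M) :
    Tendsto (fun n => energy A g (u_ n)) atTop (𝓝 (energy A g u)) ∧
      Tendsto (fun n => ‖differential h (u_ n) - differential h u‖) atTop (𝓝 0) := by
  -- `L^p` convergence of the gradients yields a.e. convergence along a further subsequence. As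
  -- every subsequence has a further one with the same limit, the whole sequence converges.
  have hsub : ∀ ns : ℕ → ℕ, Tendsto ns atTop atTop → ∃ ms : ℕ → ℕ,
      Tendsto (fun n => energy A g (u_ (ns (ms n)))) atTop (𝓝 (energy A g u)) ∧
      Tendsto (fun n => ‖differential h (u_ (ns (ms n))) - differential h u‖) atTop (𝓝 0) := by
    intro ns hns
    have hp0 : ENNReal.ofReal p ≠ 0 := by
      simp
      linarith
    obtain ⟨ms, hms, hgrad⟩ := (tendstoInMeasure_of_tendsto_eLpNorm hp0
      (fun n => (u_ (ns n)).memLp_grad.1) u.memLp_grad.1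
      (X.tendsto_eLpNorm_grad_sub (hu.comp hns))).exists_seq_tendsto_ae
    have hnm := hns.comp hms.tendsto_atTop
    exact ⟨ms, h.tendsto_of_ae_tendsto_grad hM (hae.mono fun x hx => hx.comp hnm) hgrad
      (hu.comp hnm) fun n => hbd _⟩
  exact ⟨tendsto_of_subseq_tendsto fun ns hns => (hsub ns hns).imp fun _ => And.left,
    tendsto_of_subseq_tendsto fun ns hns => (hsub ns hns).imp fun _ => And.right⟩

/-- Convergence in the norm of `X` controls `‖·‖_V` and, through `|·|_∞`, gives both a.e.
convergence and a uniform bound, so the sequential result applies. -/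
lemma Admissible.continuous_differential (h : Admissible p A g) :
    Continuous (differential h : X hp hV → X hp hV →L[ℝ] ℝ) := by
  rw [continuous_iff_seqContinuous]
  intro u_ u hu
  have hnorm : Tendsto (fun n => ‖u_ n - u‖) atTop (𝓝 0) :=
    tendsto_iff_norm_sub_tendsto_zero.1 hu
  have hV0 : Tendsto (fun n => (u_ n - u).normV) atTop (𝓝 0) :=
    squeeze_zero (fun n => X.normV_nonneg _) (fun n => X.normV_le_norm _) hnorm
  have hae : ∀ᵐ x, Tendsto (fun n => u_ n x) atTop (𝓝 (u x)) := by
    filter_upwards [ae_all_iff.2 fun n => X.coe_sub (u_ n) u,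
      ae_all_iff.2 fun n => X.ae_abs_le (u_ n - u)] with x h1 h2
    rw [tendsto_iff_norm_sub_tendsto_zero]
    refine squeeze_zero (fun n => norm_nonneg _) (fun n => ?_) hnorm
    rw [← h1 n]
    exact (h2 n).trans (X.normInfty_le_norm _)
  obtain ⟨M, hM⟩ := hu.norm.bddAbove_range
  have hbd : ∀ n, (u_ n).normInfty ≤ |M| + 1 := fun n => by
    have h1 : ‖u_ n‖ ≤ M := hM ⟨n, rfl⟩
    linarith [(u_ n).normInfty_le_norm, le_abs_self M]
  exact tendsto_iff_norm_sub_tendsto_zero.2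
    (h.tendsto_energy_differential (by positivity) hae hV0 hbd).2

end convergence

/-! ### Directional derivatives and the Fréchet derivative of `J`. -/

section differentiability

variable {N : ℕ} {p : ℝ} {V : E N → ℝ} {hp : 1 < p} {hV : IsPotential V} {A g : E N → ℝ → ℝ}

/-- The exceptional null set may depend on `t`, so the chosen representatives of `u + t • v` cannot
be differentiated in `t` pointwise. Below, the integrands are first replaced, for each `t`, by the
explicit expression in `u x + t * v x`, which leaves the integrals unchanged. -/
lemma X.coe_add_smul (u v : X hp hV) (t : ℝ) :
    (u + t • v : X hp hV) =ᵐ[volume] fun x => u x + t * v x := by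
  filter_upwards [X.coe_add u (t • v), X.coe_smul t v] with x h1 h2
  rw [h1, h2]

lemma X.grad_add_smul (u v : X hp hV) (t : ℝ) :
    (u + t • v : X hp hV).grad =ᵐ[volume] fun x => u.grad x + t • v.grad x := by
  filter_upwards [X.grad_add u (t • v), X.grad_smul t v] with x h1 h2
  rw [h1, Pi.add_apply, h2, Pi.smul_apply]

lemma X.weighted_add_smul (u v : X hp hV) (t : ℝ) :
    weighted p V (u + t • v : X hp hV) =ᵐ[volume]
      fun x => weighted p V u x + t * weighted p V v x := by
  filter_upwards [X.weighted_add u (t • v), X.weighted_smul t v] with x h1 h2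
  rw [h1, h2]

lemma norm_add_smul_le {F : Type*} [NormedAddCommGroup F] [NormedSpace ℝ F] (y z : F) {t : ℝ}
    (ht : t ∈ Ioo (-1 : ℝ) 1) : ‖y + t • z‖ ≤ ‖y‖ + ‖z‖ := by
  refine (norm_add_le _ _).trans ?_
  rw [norm_smul]
  have : ‖t‖ ≤ 1 := (abs_lt.2 ht).le
  linarith [mul_le_of_le_one_left (norm_nonneg z) this]

lemma hasDerivAt_norm_rpow_line {F : Type*} [NormedAddCommGroup F] [InnerProductSpace ℝ F]
    (hp : 1 < p) (y z : F) (t : ℝ) :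
    HasDerivAt (fun t : ℝ => ‖y + t • z‖ ^ p)
      (p * inner ℝ (‖y + t • z‖ ^ (p - 2) • (y + t • z)) z) t := by
  have h1 : HasDerivAt (fun t : ℝ => y + t • z) z t := by
    simpa using ((hasDerivAt_id t).smul_const z).const_add y
  have h2 := (hasFDerivAt_norm_rpow (y + t • z) hp).comp_hasDerivAt t h1
  refine h2.congr_deriv ?_
  rw [real_inner_smul_left, ← mul_assoc]
  rfl

lemma abs_inner_rpow_line_le {F : Type*} [NormedAddCommGroup F] [InnerProductSpace ℝ F]
    (hp : 1 < p) (y z : F) {t : ℝ} (ht : t ∈ Ioo (-1 : ℝ) 1) :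
    |inner ℝ (‖y + t • z‖ ^ (p - 2) • (y + t • z)) z| ≤ (‖y‖ + ‖z‖) ^ p := by
  refine (abs_real_inner_le_norm _ _).trans ?_
  rw [norm_rpow_sub_two_smul hp]
  have h0 : 0 ≤ ‖y‖ + ‖z‖ := by positivity
  calc ‖y + t • z‖ ^ (p - 1) * ‖z‖ ≤ (‖y‖ + ‖z‖) ^ (p - 1) * (‖y‖ + ‖z‖) :=
        mul_le_mul (Real.rpow_le_rpow (norm_nonneg _) (norm_add_smul_le y z ht) (by linarith))
          (by linarith [norm_nonneg y]) (norm_nonneg _) (by positivity)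
    _ = (‖y‖ + ‖z‖) ^ p := by
        rcases h0.eq_or_lt with h | h
        · rw [← h, mul_zero, Real.zero_rpow (by linarith)]
        · rw [← Real.rpow_add_one h.ne']
          ring_nf

lemma integrable_add_norm_rpow {F : Type*} [NormedAddCommGroup F] (hp : 1 < p)
    {f k : E N → F} (hf : MemLp f (ENNReal.ofReal p) volume)
    (hk : MemLp k (ENNReal.ofReal p) volume) :
    Integrable (fun x => (‖f x‖ + ‖k x‖) ^ p) volume := by
  have h := (hf.norm.add hk.norm).integrable_norm_rpow (by simp; linarith) ENNReal.ofReal_ne_top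
  rw [ENNReal.toReal_ofReal (by linarith)] at h
  refine h.congr (ae_of_all _ fun x => ?_)
  simp only [Pi.add_apply]
  rw [Real.norm_of_nonneg (by positivity)]

lemma hasDerivAt_energy_weight (u v : X hp hV) :
    HasDerivAt (fun t : ℝ => ∫ x, ‖weighted p V (u + t • v : X hp hV) x‖ ^ p)
      (p * ∫ x, V x * |u x| ^ (p - 2) * u x * v x) 0 := by
  have hmeas : ∀ t : ℝ, AEStronglyMeasurable
      (fun x => weighted p V u x + t • weighted p V v x) volume := fun t =>
    u.memLp_weighted.1.add (v.memLp_weighted.1.const_smul t)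
  have h := hasDerivAt_integral_of_dominated_loc_of_deriv_le (μ := (volume : Measure (E N)))
    (x₀ := (0 : ℝ)) (s := Ioo (-1 : ℝ) 1)
    (F := fun t x => ‖weighted p V u x + t • weighted p V v x‖ ^ p)
    (F' := fun t x => p * inner ℝ (‖weighted p V u x + t • weighted p V v x‖ ^ (p - 2) •
      (weighted p V u x + t • weighted p V v x)) (weighted p V v x))
    (bound := fun x => p * (‖weighted p V u x‖ + ‖weighted p V v x‖) ^ p)
    (Ioo_mem_nhds (by norm_num) (by norm_num))
    (Eventually.of_forall fun t =>
      ((hmeas t).norm.aemeasurable.pow_const p).aestronglyMeasurable)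
    (by simpa using u.integrable_weighted_rpow)
    ((((continuous_rpow_sub_two_smul hp).comp_aestronglyMeasurable (hmeas 0)).inner
      v.memLp_weighted.1).const_mul p)
    (ae_of_all _ fun x t ht => by
      rw [norm_mul, Real.norm_of_nonneg (by linarith : 0 ≤ p)]
      exact mul_le_mul_of_nonneg_left (abs_inner_rpow_line_le hp _ _ ht) (by linarith))
    ((integrable_add_norm_rpow hp u.memLp_weighted v.memLp_weighted).const_mul p)
    (ae_of_all _ fun x t _ => hasDerivAt_norm_rpow_line hp _ _ t)
  refine (h.2.congr_deriv ?_).congr_of_eventuallyEq (Eventually.of_forall fun t => ?_)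
  -- The density `c` involves neither `A` nor `g`, so any values may be inserted.
  · rw [← integral_congr_ae (diffDensity_c_mul_ae (A := 0) (g := 0) u v), ← integral_const_mul]
    congr 1
    ext x
    simp only [zero_smul, add_zero, diffDensity, RCLike.inner_apply, conj_trivial]
    ring
  · refine integral_congr_ae ?_
    filter_upwards [X.weighted_add_smul u v t] with x hx
    rw [hx, smul_eq_mul]

lemma Admissible.hasDerivAt_energy_source (h : Admissible p A g) (u v : X hp hV) :
    HasDerivAt (fun t : ℝ => ∫ x, primitive g x ((u + t • v : X hp hV) x))
      (∫ x, g x (u x) * v x) 0 := by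
  obtain ⟨C, hC, hb⟩ := h.exists_bound hp (ρ := u.normInfty + v.normInfty + 1)
    (by linarith [u.normInfty_nonneg, v.normInfty_nonneg])
  have hmeas : ∀ t : ℝ, AEStronglyMeasurable
      (fun x => primitive g x (u x + t * v x)) volume := fun t =>
    (h.source.primitive.aestronglyMeasurable (u + t • v)).congr (by
      filter_upwards [X.coe_add_smul u v t] with x hx
      rw [hx])
  have hint := h.integralsConverge u v
  have hd := hasDerivAt_integral_of_dominated_loc_of_deriv_le (μ := (volume : Measure (E N)))
    (x₀ := (0 : ℝ)) (s := Ioo (-1 : ℝ) 1)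
    (F := fun t x => primitive g x (u x + t * v x))
    (F' := fun t x => g x (u x + t * v x) * v x)
    (bound := fun x => C * (‖u x‖ + ‖v x‖) ^ p)
    (Ioo_mem_nhds (by norm_num) (by norm_num))
    (Eventually.of_forall hmeas)
    (by simpa using hint.energy_G)
    (by simpa using hint.diff_g.1)
    (by
      filter_upwards [hb, u.ae_abs_le, v.ae_abs_le] with x hx hu hv t ht
      have h1 := norm_add_smul_le (u x) (v x) ht
      rw [smul_eq_mul] at h1
      have h2 : |u x + t * v x| ≤ u.normInfty + v.normInfty + 1 := by
        rw [Real.norm_eq_abs, Real.norm_eq_abs, Real.norm_eq_abs] at h1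
        linarith
      have h0 : 0 ≤ ‖u x‖ + ‖v x‖ := by positivity
      rw [norm_mul]
      calc ‖g x (u x + t * v x)‖ * ‖v x‖
          ≤ C * (‖u x‖ + ‖v x‖) ^ (p - 1) * (‖u x‖ + ‖v x‖) := by
            refine mul_le_mul ?_ (by linarith [norm_nonneg (u x)]) (norm_nonneg _)
              (by positivity)
            refine (hx _ h2).2.2.1.trans (mul_le_mul_of_nonneg_left ?_ hC)
            exact Real.rpow_le_rpow (abs_nonneg _) h1 (by linarith)
        _ = C * (‖u x‖ + ‖v x‖) ^ p := by
            rw [mul_assoc]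
            congr 1
            rcases h0.eq_or_lt with h | h
            · rw [← h, mul_zero, Real.zero_rpow (by linarith)]
            · rw [← Real.rpow_add_one h.ne']
              ring_nf)
    ((integrable_add_norm_rpow hp u.memLp v.memLp).const_mul C)
    (by
      filter_upwards [h.source.ae_hasDerivAt_primitive] with x hx t _
      have h1 : HasDerivAt (fun t : ℝ => u x + t * v x) (v x) t := by
        simpa using ((hasDerivAt_id t).mul_const (v x)).const_add (u x)
      exact (hx _).comp t h1)
  refine (hd.2.congr_deriv ?_).congr_of_eventuallyEq (Eventually.of_forall fun t => ?_)
  · simp only [zero_mul, add_zero]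
  · refine integral_congr_ae ?_
    filter_upwards [X.coe_add_smul u v t] with x hx
    rw [hx]

/-- For `|t| < 1` the values `u x + t v x` stay in a fixed interval where `A` and `A_t` are bounded
by `C`. The term with `A_t` carries a factor `v x`, absorbed by `|v|_∞`, so both terms are dominated
by a multiple of `(|∇u| + |∇v|)^p`. -/
lemma Admissible.hasDerivAt_energy_gradient (h : Admissible p A g) (u v : X hp hV) :
    HasDerivAt (fun t : ℝ => ∫ x, A x ((u + t • v : X hp hV) x) *
        ‖(u + t • v : X hp hV).grad x‖ ^ p)
      ((∫ x, partialT A x (u x) * v x * ‖u.grad x‖ ^ p) +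
        p * ∫ x, A x (u x) * ‖u.grad x‖ ^ (p - 2) * inner ℝ (u.grad x) (v.grad x)) 0 := by
  have hnv := v.normInfty_nonneg
  obtain ⟨C, hC, hb⟩ := h.exists_bound hp (ρ := u.normInfty + v.normInfty + 1)
    (by linarith [u.normInfty_nonneg])
  have hmeas : ∀ t : ℝ, AEStronglyMeasurable
      (fun x => A x (u x + t * v x) * ‖u.grad x + t • v.grad x‖ ^ p) volume := fun t =>
    (h.aestronglyMeasurable_energy (u + t • v)).congr (by
      filter_upwards [X.coe_add_smul u v t, X.grad_add_smul u v t] with x h1 h2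
      rw [h1, h2])
  have hint := h.integralsConverge u v
  have hF0 : (fun x => partialT A x (u x + 0 * v x) * v x * ‖u.grad x + (0 : ℝ) • v.grad x‖ ^ p +
      A x (u x + 0 * v x) * (p * inner ℝ (‖u.grad x + (0 : ℝ) • v.grad x‖ ^ (p - 2) •
        (u.grad x + (0 : ℝ) • v.grad x)) (v.grad x))) =
      fun x => partialT A x (u x) * v x * ‖u.grad x‖ ^ p +
        p * (A x (u x) * ‖u.grad x‖ ^ (p - 2) * inner ℝ (u.grad x) (v.grad x)) := by
    ext x
    simp only [zero_mul, zero_smul, add_zero, real_inner_smul_left]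
    ring
  have hd := hasDerivAt_integral_of_dominated_loc_of_deriv_le (μ := (volume : Measure (E N)))
    (x₀ := (0 : ℝ)) (s := Ioo (-1 : ℝ) 1)
    (F := fun t x => A x (u x + t * v x) * ‖u.grad x + t • v.grad x‖ ^ p)
    (F' := fun t x => partialT A x (u x + t * v x) * v x * ‖u.grad x + t • v.grad x‖ ^ p +
      A x (u x + t * v x) * (p * inner ℝ (‖u.grad x + t • v.grad x‖ ^ (p - 2) •
        (u.grad x + t • v.grad x)) (v.grad x)))
    (bound := fun x => (C * v.normInfty + C * p) * (‖u.grad x‖ + ‖v.grad x‖) ^ p)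
    (Ioo_mem_nhds (by norm_num) (by norm_num))
    (Eventually.of_forall hmeas)
    (by simpa using hint.energy_A)
    (by
      rw [hF0]
      exact (hint.diff_At.add (hint.diff_A.const_mul p)).1)
    (by
      filter_upwards [hb, u.ae_abs_le, v.ae_abs_le] with x hx hu hv t ht
      have h2 : |u x + t * v x| ≤ u.normInfty + v.normInfty + 1 := by
        have h1 := norm_add_smul_le (u x) (v x) ht
        rw [smul_eq_mul, Real.norm_eq_abs, Real.norm_eq_abs, Real.norm_eq_abs] at h1
        linarith
      obtain ⟨e1, e2, -, -⟩ := hx _ h2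
      have h3 : ‖u.grad x + t • v.grad x‖ ^ p ≤ (‖u.grad x‖ + ‖v.grad x‖) ^ p :=
        Real.rpow_le_rpow (norm_nonneg _) (norm_add_smul_le _ _ ht) (by linarith)
      have h4 := abs_inner_rpow_line_le hp (u.grad x) (v.grad x) ht
      rw [add_mul]
      refine (norm_add_le _ _).trans (add_le_add ?_ ?_)
      · rw [norm_mul, norm_mul, Real.norm_of_nonneg (by positivity :
          0 ≤ ‖u.grad x + t • v.grad x‖ ^ p)]
        exact mul_le_mul (mul_le_mul e2 hv (abs_nonneg _) hC) h3 (by positivity) (by positivity)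
      · rw [norm_mul, norm_mul, Real.norm_of_nonneg (by linarith : 0 ≤ p), mul_assoc]
        exact mul_le_mul e1 (mul_le_mul_of_nonneg_left h4 (by linarith))
          (mul_nonneg (by linarith) (norm_nonneg _)) hC)
    ((integrable_add_norm_rpow hp u.memLp_grad v.memLp_grad).const_mul _)
    (by
      filter_upwards [h.coeff.ae_hasDerivAt] with x hx t _
      have h1 : HasDerivAt (fun t : ℝ => u x + t * v x) (v x) t := by
        simpa using ((hasDerivAt_id t).mul_const (v x)).const_add (u x)
      exact ((hx _).comp t h1).mul (hasDerivAt_norm_rpow_line hp _ _ t))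
  refine (hd.2.congr_deriv ?_).congr_of_eventuallyEq (Eventually.of_forall fun t => ?_)
  · rw [hF0, integral_add hint.diff_At (hint.diff_A.const_mul p), integral_const_mul]
  · refine integral_congr_ae ?_
    filter_upwards [X.coe_add_smul u v t, X.grad_add_smul u v t] with x h1 h2
    rw [h1, h2]

/-- The energy has directional derivatives, given by `dJ`. -/
lemma Admissible.hasDerivAt_energy (h : Admissible p A g) (u v : X hp hV) (t : ℝ) :
    HasDerivAt (fun t : ℝ => energy A g (u + t • v)) (differential h (u + t • v) v) t := by
  -- The derivative at `0` from every base point is enough, since `u + s • v = (u + t • v) + (s - t)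
  -- • v`.
  have zero : ∀ w : X hp hV,
      HasDerivAt (fun s : ℝ => energy A g (w + s • v)) (differential h w v) 0 := by
    intro w
    have hp0 : p ≠ 0 := by linarith
    simp_rw [energy_eq]
    refine ((((h.hasDerivAt_energy_gradient w v).const_mul (1 / p)).add
      ((hasDerivAt_energy_weight w v).const_mul (1 / p))).sub
      (h.hasDerivAt_energy_source w v)).congr_deriv ?_
    rw [differential_apply, diffEnergy]
    field_simp
    ring
  have h1 := zero (u + t • v)
  rw [← sub_self t] at h1
  have h2 := h1.comp_sub_const t t
  refine h2.congr_of_eventuallyEq (Eventually.of_forall fun s => ?_)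
  simp only
  congr 1
  rw [sub_smul]
  abel

/-- The mean value inequality is applied on `[0,1]` to `t ↦ J(u + tv) - t dJ(u)v`. Its derivative is
`(dJ(u + tv) - dJ(u))v`, at most `ε‖v‖` for small `v` by continuity of `dJ`. -/
lemma Admissible.hasFDerivAt_energy (h : Admissible p A g) (u : X hp hV) :
    HasFDerivAt (energy A g : X hp hV → ℝ) (differential h u) u := by
  rw [hasFDerivAt_iff_isLittleO_nhds_zero, Asymptotics.isLittleO_iff]
  intro ε hε
  obtain ⟨δ, hδ, hball⟩ := Metric.continuousAt_iff.1
    (h.continuous_differential (hp := hp) (hV := hV).continuousAt (x := u)) ε hε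
  filter_upwards [Metric.ball_mem_nhds (0 : X hp hV) hδ] with v hv
  rw [mem_ball_zero_iff] at hv
  have hder : ∀ t ∈ Icc (0 : ℝ) 1, HasDerivWithinAt
      (fun t : ℝ => energy A g (u + t • v) - t * differential h u v)
      (differential h (u + t • v) v - differential h u v) (Icc 0 1) t := by
    intro t _
    have h1 : HasDerivAt (fun t : ℝ => t * differential h u v) (differential h u v) t := by
      simpa using (hasDerivAt_id t).mul_const (differential h u v)
    exact ((h.hasDerivAt_energy u v t).sub h1).hasDerivWithinAt
  have key := norm_image_sub_le_of_norm_deriv_le_segment_01' (C := ε * ‖v‖) hder fun t ht => by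
    rw [← sub_apply]
    refine (ContinuousLinearMap.le_opNorm _ _).trans
      (mul_le_mul_of_nonneg_right ?_ (norm_nonneg _))
    have hd : dist (u + t • v) u < δ := by
      rw [dist_self_add_left, norm_smul, Real.norm_of_nonneg ht.1]
      exact (mul_le_of_le_one_left (norm_nonneg _) ht.2.le).trans_lt hv
    have := hball hd
    rw [dist_eq_norm] at this
    exact this.le
  refine le_trans (le_of_eq ?_) key
  simp only [one_smul, zero_smul, add_zero, one_mul, zero_mul, sub_zero]
  congr 1
  ring

end differentiability

end WeightedSobolev

/-! ### Assembly of the theorem. -/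

theorem proposition3p7 {N : ℕ} (hN : 2 ≤ N) {p : ℝ} (hp : 1 < p)
    {V : WeightedSobolev.E N → ℝ} (hV : WeightedSobolev.IsPotential V)
    {A g : WeightedSobolev.E N → ℝ → ℝ}
    (hA : WeightedSobolev.IsCaratheodory 1 A)
    (hA_bdd : WeightedSobolev.LocallyEssBounded A)
    (hAt_bdd : WeightedSobolev.LocallyEssBounded (WeightedSobolev.partialT A))
    (hg : WeightedSobolev.IsCaratheodory 0 g)
    (hg_growth : WeightedSobolev.HasGrowth p g) :
    (∀ u v : WeightedSobolev.X hp hV, WeightedSobolev.IntegralsConverge A g u v) ∧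
    ∃ dJ : WeightedSobolev.X hp hV → (WeightedSobolev.X hp hV →L[ℝ] ℝ),
      (∀ u v : WeightedSobolev.X hp hV, dJ u v = WeightedSobolev.diffEnergy A g u v) ∧
      (∀ (u_ : ℕ → WeightedSobolev.X hp hV) (u : WeightedSobolev.X hp hV) (M : ℝ), 0 < M →
        (∀ᵐ x ∂(volume : Measure (WeightedSobolev.E N)),
          Tendsto (fun n => u_ n x) atTop (𝓝 (u x))) →
        Tendsto (fun n => (u_ n - u).normV) atTop (𝓝 0) →
        (∀ n, (u_ n).normInfty ≤ M) →
        Tendsto (fun n => WeightedSobolev.energy A g (u_ n)) atTop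
            (𝓝 (WeightedSobolev.energy A g u)) ∧
          Tendsto (fun n => ‖dJ (u_ n) - dJ u‖) atTop (𝓝 0)) ∧
      (∀ u : WeightedSobolev.X hp hV,
        HasFDerivAt (WeightedSobolev.energy A g : WeightedSobolev.X hp hV → ℝ) (dJ u) u) ∧
      ContDiff ℝ 1 (WeightedSobolev.energy A g : WeightedSobolev.X hp hV → ℝ) := by
  have h : WeightedSobolev.Admissible p A g := ⟨hA, hA_bdd, hAt_bdd, hg, hg_growth⟩
  refine ⟨h.integralsConverge, WeightedSobolev.differential h,
    WeightedSobolev.differential_apply h, ?_, h.hasFDerivAt_energy, ?_⟩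
  · intro u_ u M hM hae hu hbd
    exact h.tendsto_energy_differential hM hae hu hbd
  · exact contDiff_one_iff_hasFDerivAt.2
      ⟨WeightedSobolev.differential h, h.continuous_differential, h.hasFDerivAt_energy⟩
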